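/- All Hilbert spaces are finite-dimensional and non-zero, a state is a positive operator of trace one, $H(\rho)=-\mathrm{tr}(\rho\log\rho)$ is the von Neumann entropy, and a channel $\mathcal N:\mathbb B(H_{A'})\to\mathbb B(H_B)$ is a completely positive trace preserving linear map. For a bipartite state put $I(A;B)_\rho=H(\rho^A)+H(\rho^B)-H(\rho^{AB})$ and $I_c(A\rangle B)_\rho=H(\rho^B)-H(\rho^{AB})$. If $V:H_{A'}\to H_B\otimes H_E$ is a Stinespring isometry of $\mathcal N$, i.e. $\mathcal N(\rho)=\mathrm{tr}_E(V\rho V^*)$, let $\mathcal N^E(\rho)=\mathrm{tr}_B(V\rho V^*)$. Define $$\chi(\mathcal N)=\sup_{\rho^{XA'}} I(X;B)_\omega,\qquad Q^{(1)}(\mathcal N)=\sup_{\rho^{AA'}} I_c(A\rangle B)_\omega,\qquad P^{(1)}(\mathcal N)=\sup_{\rho^{XA'}}\big(I(X;B)_\omega-I(X;E)_\omega\big),$$ where $\rho^{AA'}$ runs over all bipartite states ($A$ any finite-dimensional system), $\rho^{XA'}=\sum_x p(x)|x\rangle\langle x|\otimes\rho_x$ runs over all classical-quantum states ($X$ any finite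 alphabet), and $\omega$ is the output, with $\omega^{AB}=(\mathrm{id}\otimes\mathcal N)(\rho^{AA'})$, $\omega^{XB}=(\mathrm{id}\otimes\mathcal N)(\rho^{XA'})$ and $\omega^{XE}=(\mathrm{id}\otimes\mathcal N^E)(\rho^{XA'})$ (the value of $I(X;E)_\omega$ does not depend on the choice of $V$, so the supremum in $P^{(1)}$ may be taken over all Stinespring isometries as well). The potential quantities are $$\chi^{(p)}(\mathcal N)=\sup_{\mathcal M}\big(\chi(\mathcal N\otimes\mathcal M)-\chi(\mathcal M)\big),\quad Q^{(p)}(\mathcal N)=\sup_{\mathcal M}\big(Q^{(1)}(\mathcal N\otimes\mathcal M)-Q^{(1)}(\mathcal M)\big),\quad P^{(p)}(\mathcal N)=\sup_{\mathcal M}\big(P^{(1)}(\mathcal N\otimes\mathcal M)-P^{(1)}(\mathcal M)\big),$$ where $\mathcal M$ runs over all channels. \textbf{Proposition.} For every channel these six suprema are finite, and each of the six functions $F\in\{\chi,\,Q^{(1)},\,P^{(1)},\,\chi^{(p)},\,Q^{(p)},\,P^{(p)}\}$ is convex on the convex set of channels with given input and output spaces: for all channels $\mathcal N,\mathcal M:\mathbb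 B(H_{A'})\to\mathbb B(H_B)$ and all $\lambda\in[0,1]$, $$F(\lambda\mathcal N+(1-\lambda)\mathcal M)\le\lambda F(\mathcal N)+(1-\lambda)F(\mathcal M).$$ -/

import Mathlib

open scoped Kronecker ComplexOrder

namespace QChannel

noncomputable section

/-! ## States, partial traces and entropies -/

/-- A state: a positive semidefinite matrix of trace one. -/
def IsState {n : Type*} [Fintype n] (ρ : Matrix n n ℂ) : Prop :=
  ρ.PosSemidef ∧ ρ.trace = 1

/-- The partial trace over the first tensor factor, `ρ^{AB} ↦ ρ^B`. -/
def traceFst {m n : Type*} [Fintype m] :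
    Matrix (m × n) (m × n) ℂ →ₗ[ℂ] Matrix n n ℂ where
  toFun ρ := Matrix.of fun j j' => ∑ i, ρ (i, j) (i, j')
  map_add' ρ σ := by ext; simp [Finset.sum_add_distrib]
  map_smul' c ρ := by ext; simp [Finset.mul_sum]

/-- The partial trace over the second tensor factor, `ρ^{AB} ↦ ρ^A`. -/
def traceSnd {m n : Type*} [Fintype n] :
    Matrix (m × n) (m × n) ℂ →ₗ[ℂ] Matrix m m ℂ where
  toFun ρ := Matrix.of fun i i' => ∑ j, ρ (i, j) (i', j)
  map_add' ρ σ := by ext; simp [Finset.sum_add_distrib]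
  map_smul' c ρ := by ext; simp [Finset.mul_sum]

/-- The von Neumann entropy `H(ρ) = -tr(ρ log ρ)` (natural logarithm; `Real.log 0 = 0` in Lean, which
gives the usual convention `0 log 0 = 0`). -/
def entropy {n : Type*} [Fintype n] [DecidableEq n] (ρ : Matrix n n ℂ) : ℝ :=
  -(ρ * cfc Real.log ρ).trace.re

/-- The mutual information `I(A:B)_ρ = H(ρ^A) + H(ρ^B) - H(ρ^{AB})`. -/
def mutualInfo {m n : Type*} [Fintype m] [DecidableEq m] [Fintype n] [DecidableEq n]
    (ρ : Matrix (m × n) (m × n) ℂ) : ℝ :=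
  entropy (traceSnd ρ) + entropy (traceFst ρ) - entropy ρ

/-- The coherent information `I_c(A⟩B)_ρ = H(ρ^B) - H(ρ^{AB})`. -/
def coherentInfo {m n : Type*} [Fintype m] [DecidableEq m] [Fintype n] [DecidableEq n]
    (ρ : Matrix (m × n) (m × n) ℂ) : ℝ :=
  entropy (traceFst ρ) - entropy ρ

/-- The entropy is the Shannon entropy of the eigenvalues. -/
theorem entropy_eq_sum {n : Type*} [Fintype n] [DecidableEq n] {ρ : Matrix n n ℂ}
    (hρ : ρ.IsHermitian) : entropy ρ = ∑ i, Real.negMulLog (hρ.eigenvalues i) := by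
  have h1 : ρ * cfc Real.log ρ = cfc (fun x : ℝ => x * Real.log x) ρ := by
    have hsa : IsSelfAdjoint ρ := hρ
    have hfin : (spectrum ℝ ρ).Finite := Matrix.finite_real_spectrum
    rw [cfc_mul (fun x : ℝ => x) Real.log ρ (hfin.continuousOn _) (hfin.continuousOn _)]
    rw [cfc_id' ℝ ρ]
  rw [entropy, h1, hρ.cfc_eq, Matrix.IsHermitian.cfc, Unitary.conjStarAlgAut_apply,
    Matrix.trace_mul_cycle]
  simp [Matrix.trace, Real.negMulLog, Finset.sum_neg_distrib]

/-! ## Channels -/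

/-- The tensor product `N ⊗ M` of two linear maps between matrix algebras. -/
def tensorMap {a b c d : Type*} [Fintype a] [DecidableEq a] [Fintype b] [DecidableEq b]
    [Fintype c] [DecidableEq c] [Fintype d] [DecidableEq d]
    (N : Matrix a a ℂ →ₗ[ℂ] Matrix b b ℂ) (M : Matrix c c ℂ →ₗ[ℂ] Matrix d d ℂ) :
    Matrix (a × c) (a × c) ℂ →ₗ[ℂ] Matrix (b × d) (b × d) ℂ :=
  (kroneckerLinearEquiv b b d d ℂ).toLinearMap ∘ₗ TensorProduct.map N M ∘ₗ
    (kroneckerLinearEquiv a a c c ℂ).symm.toLinearMap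

theorem tensorMap_kronecker {a b c d : Type*} [Fintype a] [DecidableEq a] [Fintype b]
    [DecidableEq b] [Fintype c] [DecidableEq c] [Fintype d] [DecidableEq d]
    (N : Matrix a a ℂ →ₗ[ℂ] Matrix b b ℂ) (M : Matrix c c ℂ →ₗ[ℂ] Matrix d d ℂ)
    (A : Matrix a a ℂ) (C : Matrix c c ℂ) :
    tensorMap N M (A ⊗ₖ C) = N A ⊗ₖ M C := by
  simp [tensorMap]

/-- `id ⊗ N` applies `N` to every block. -/
theorem tensorMap_id_apply {k a b : Type*} [Fintype k] [DecidableEq k] [Fintype a]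
    [DecidableEq a] [Fintype b] [DecidableEq b] (N : Matrix a a ℂ →ₗ[ℂ] Matrix b b ℂ)
    (ρ : Matrix (k × a) (k × a) ℂ) (x y : k) (i j : b) :
    tensorMap LinearMap.id N ρ (x, i) (y, j) = N (Matrix.of fun i' j' => ρ (x, i') (y, j')) i j := by
  have hρ : ρ = ∑ p : k, ∑ q : k,
      Matrix.single p q 1 ⊗ₖ (Matrix.of fun i' j' => ρ (p, i') (q, j')) := by
    ext ⟨p, i'⟩ ⟨q, j'⟩
    simp [Matrix.sum_apply, Matrix.single_apply, ite_and]
  conv_lhs => rw [hρ]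
  simp only [map_sum, tensorMap_kronecker, Matrix.sum_apply, Matrix.kroneckerMap_apply]
  simp [Matrix.single_apply, ite_and]

section CompletelyPositive

open scoped Matrix.Norms.L2Operator MatrixOrder CStarAlgebra

/-- Complete positivity, as in Mathlib, for the C⋆-algebras of matrices with the Loewner order. -/
def IsCompletelyPositive {a b : Type*} [Fintype a] [DecidableEq a] [Fintype b] [DecidableEq b]
    (N : Matrix a a ℂ →ₗ[ℂ] Matrix b b ℂ) : Prop :=
  ∃ Φ : Matrix a a ℂ →CP Matrix b b ℂ, Φ.toLinearMap = N

theorem cstarMatrix_nonneg_iff {a : Type*} [Fintype a] [DecidableEq a] {k : ℕ}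
    (M : CStarMatrix (Fin k) (Fin k) (Matrix a a ℂ)) :
    0 ≤ M ↔ (Matrix.of fun p q : Fin k × a => M p.1 q.1 p.2 q.2).PosSemidef := by
  have h1 : ∀ {A : Type _} [NonUnitalCStarAlgebra A] [PartialOrder A] [StarOrderedRing A] (x : A),
      0 ≤ x ↔ ∃ y, x = star y * y := fun x => CStarAlgebra.nonneg_iff_eq_star_mul_self
  refine (h1 M).trans ?_
  rw [← Matrix.nonneg_iff_posSemidef, CStarAlgebra.nonneg_iff_eq_star_mul_self]
  constructor
  · rintro ⟨y, rfl⟩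
    refine ⟨Matrix.of fun p q : Fin k × a => y p.1 q.1 p.2 q.2, ?_⟩
    ext ⟨x, i⟩ ⟨x', i'⟩
    simp [CStarMatrix.mul_apply, CStarMatrix.star_apply, Matrix.mul_apply, Matrix.sum_apply,
      Fintype.sum_prod_type]
  · rintro ⟨y, hy⟩
    refine ⟨CStarMatrix.ofMatrix (Matrix.of fun x x' => Matrix.of fun i i' => y (x, i) (x', i')), ?_⟩
    ext x x' i i'
    have := congrFun (congrFun hy (x, i)) (x', i')
    simp only [Matrix.of_apply] at this
    rw [this]
    simp [CStarMatrix.mul_apply, CStarMatrix.star_apply, Matrix.mul_apply, Matrix.sum_apply,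
      Fintype.sum_prod_type]

/-- Complete positivity means that every ampliation `id_k ⊗ N` preserves positive
semidefiniteness. -/
theorem isCompletelyPositive_iff {a b : Type*} [Fintype a] [DecidableEq a] [Fintype b]
    [DecidableEq b] (N : Matrix a a ℂ →ₗ[ℂ] Matrix b b ℂ) :
    IsCompletelyPositive N ↔ ∀ (k : ℕ) (ρ : Matrix (Fin k × a) (Fin k × a) ℂ),
      ρ.PosSemidef → (tensorMap LinearMap.id N ρ).PosSemidef := by
  have key : ∀ (k : ℕ) (M : CStarMatrix (Fin k) (Fin k) (Matrix a a ℂ)),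
      (Matrix.of fun p q : Fin k × b => (M.map N) p.1 q.1 p.2 q.2) =
        tensorMap LinearMap.id N (Matrix.of fun p q : Fin k × a => M p.1 q.1 p.2 q.2) := by
    intro k M
    ext ⟨x, i⟩ ⟨y, j⟩
    rw [tensorMap_id_apply]
    rfl
  constructor
  · rintro ⟨Φ, rfl⟩ k ρ hρ
    have := Φ.map_cstarMatrix_nonneg' k (CStarMatrix.ofMatrix
      (Matrix.of fun x y => Matrix.of fun i j => ρ (x, i) (y, j)))
      ((cstarMatrix_nonneg_iff _).2 hρ)
    rw [cstarMatrix_nonneg_iff] at this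
    erw [key] at this
    exact this
  · intro h
    refine ⟨{ N with map_cstarMatrix_nonneg' := ?_ }, rfl⟩
    intro k M hM
    rw [cstarMatrix_nonneg_iff] at hM ⊢
    erw [key]
    exact h k _ hM

end CompletelyPositive

/-- A quantum channel: a completely positive trace preserving linear map. -/
def IsChannel {a b : Type*} [Fintype a] [DecidableEq a] [Fintype b] [DecidableEq b]
    (N : Matrix a a ℂ →ₗ[ℂ] Matrix b b ℂ) : Prop :=
  IsCompletelyPositive N ∧ ∀ ρ, (N ρ).trace = ρ.trace

/-- The set of all channels with input system `a` and output system `b`. -/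
def channels (a b : Type*) [Fintype a] [DecidableEq a] [Fintype b] [DecidableEq b] :
    Set (Matrix a a ℂ →ₗ[ℂ] Matrix b b ℂ) :=
  {N | IsChannel N}

/-- `V : H_A → H_B ⊗ H_E` is the isometry of a Stinespring dilation `N(ρ) = tr_E(V ρ V^*)`. -/
def IsStinespring {a b : Type*} [Fintype a] [DecidableEq a] [Fintype b] [DecidableEq b] {e : ℕ}
    (N : Matrix a a ℂ →ₗ[ℂ] Matrix b b ℂ) (V : Matrix (b × Fin e) a ℂ) : Prop :=
  V.conjTranspose * V = 1 ∧ ∀ ρ, N ρ = traceSnd (V * ρ * V.conjTranspose)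

/-- The complementary channel `N^E(ρ) = tr_B(V ρ V^*)` of a Stinespring isometry `V`. -/
def complementary {a b : Type*} [Fintype a] [Fintype b] {e : ℕ}
    (V : Matrix (b × Fin e) a ℂ) : Matrix a a ℂ →ₗ[ℂ] Matrix (Fin e) (Fin e) ℂ where
  toFun ρ := traceFst (V * ρ * V.conjTranspose)
  map_add' ρ σ := by simp [Matrix.mul_add, Matrix.add_mul]
  map_smul' c ρ := by simp

/-! ## One-shot quantities -/

/-- A classical-quantum state `ρ^{XA} = ∑ₓ p(x) |x⟩⟨x| ⊗ ρₓ`. -/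
def IsClassicalQuantum {k : ℕ} {a : Type*} [Fintype a]
    (ρ : Matrix (Fin k × a) (Fin k × a) ℂ) : Prop :=
  ∃ (p : Fin k → ℝ) (σ : Fin k → Matrix a a ℂ), (∀ x, 0 ≤ p x) ∧ ∑ x, p x = 1 ∧
    (∀ x, IsState (σ x)) ∧ ρ = ∑ x, (p x : ℂ) • (Matrix.single x x 1 ⊗ₖ σ x)

/-- The values `I(X;B)_ω`, where `ω^{XB} = (id ⊗ N)(ρ^{XA'})` and `ρ^{XA'}` is classical-quantum. -/
def holevoValues {a b : Type*} [Fintype a] [DecidableEq a] [Fintype b] [DecidableEq b]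
    (N : Matrix a a ℂ →ₗ[ℂ] Matrix b b ℂ) : Set ℝ :=
  {r | ∃ (k : ℕ) (ρ : Matrix (Fin k × a) (Fin k × a) ℂ), IsClassicalQuantum ρ ∧
    r = mutualInfo (tensorMap LinearMap.id N ρ)}

/-- The values `I_c(A⟩B)_ω`, where `ω^{AB} = (id ⊗ N)(ρ^{AA'})` and `ρ^{AA'}` is a bipartite
state. -/
def coherentValues {a b : Type*} [Fintype a] [DecidableEq a] [Fintype b] [DecidableEq b]
    (N : Matrix a a ℂ →ₗ[ℂ] Matrix b b ℂ) : Set ℝ :=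
  {r | ∃ (k : ℕ) (ρ : Matrix (Fin k × a) (Fin k × a) ℂ), IsState ρ ∧
    r = coherentInfo (tensorMap LinearMap.id N ρ)}

/-- The values `I(X;B)_ω - I(X;E)_ω`, where `ρ^{XA'}` is classical-quantum, `V : A' → BE` is a
Stinespring isometry of `N`, and `ω` is the output of `ρ` under `id ⊗ V`. All Stinespring isometries
give the same values. -/
def privateValues {a b : Type*} [Fintype a] [DecidableEq a] [Fintype b] [DecidableEq b]
    (N : Matrix a a ℂ →ₗ[ℂ] Matrix b b ℂ) : Set ℝ :=
  {r | ∃ (e : ℕ) (V : Matrix (b × Fin e) a ℂ) (k : ℕ) (ρ : Matrix (Fin k × a) (Fin k × a) ℂ),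
    IsStinespring N V ∧ IsClassicalQuantum ρ ∧
    r = mutualInfo (tensorMap LinearMap.id N ρ) -
      mutualInfo (tensorMap LinearMap.id (complementary V) ρ)}

/-- The Holevo information `χ(N)`. -/
def chi {a b : Type*} [Fintype a] [DecidableEq a] [Fintype b] [DecidableEq b]
    (N : Matrix a a ℂ →ₗ[ℂ] Matrix b b ℂ) : ℝ :=
  sSup (holevoValues N)

/-- The one-shot quantum capacity `Q^{(1)}(N)`. -/
def qOne {a b : Type*} [Fintype a] [DecidableEq a] [Fintype b] [DecidableEq b]
    (N : Matrix a a ℂ →ₗ[ℂ] Matrix b b ℂ) : ℝ :=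
  sSup (coherentValues N)

/-- The one-shot private capacity `P^{(1)}(N)`. -/
def pOne {a b : Type*} [Fintype a] [DecidableEq a] [Fintype b] [DecidableEq b]
    (N : Matrix a a ℂ →ₗ[ℂ] Matrix b b ℂ) : ℝ :=
  sSup (privateValues N)

/-! ## Potential capacities

The auxiliary channel `M` runs over all channels between nonzero finite-dimensional systems. -/

/-- The values `χ(N ⊗ M) - χ(M)`, over all channels `M`. -/
def chiPotValues {a b : Type*} [Fintype a] [DecidableEq a] [Fintype b] [DecidableEq b]
    (N : Matrix a a ℂ →ₗ[ℂ] Matrix b b ℂ) : Set ℝ :=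
  {r | ∃ (c d : ℕ) (M : Matrix (Fin c) (Fin c) ℂ →ₗ[ℂ] Matrix (Fin d) (Fin d) ℂ),
    0 < c ∧ 0 < d ∧ IsChannel M ∧ r = chi (tensorMap N M) - chi M}

/-- The values `Q^{(1)}(N ⊗ M) - Q^{(1)}(M)`, over all channels `M`. -/
def qPotValues {a b : Type*} [Fintype a] [DecidableEq a] [Fintype b] [DecidableEq b]
    (N : Matrix a a ℂ →ₗ[ℂ] Matrix b b ℂ) : Set ℝ :=
  {r | ∃ (c d : ℕ) (M : Matrix (Fin c) (Fin c) ℂ →ₗ[ℂ] Matrix (Fin d) (Fin d) ℂ),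
    0 < c ∧ 0 < d ∧ IsChannel M ∧ r = qOne (tensorMap N M) - qOne M}

/-- The values `P^{(1)}(N ⊗ M) - P^{(1)}(M)`, over all channels `M`. -/
def pPotValues {a b : Type*} [Fintype a] [DecidableEq a] [Fintype b] [DecidableEq b]
    (N : Matrix a a ℂ →ₗ[ℂ] Matrix b b ℂ) : Set ℝ :=
  {r | ∃ (c d : ℕ) (M : Matrix (Fin c) (Fin c) ℂ →ₗ[ℂ] Matrix (Fin d) (Fin d) ℂ),
    0 < c ∧ 0 < d ∧ IsChannel M ∧ r = pOne (tensorMap N M) - pOne M}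

/-- The potential Holevo information `χ^{(p)}(N) = sup_M (χ(N ⊗ M) - χ(M))`. -/
def chiPot {a b : Type*} [Fintype a] [DecidableEq a] [Fintype b] [DecidableEq b]
    (N : Matrix a a ℂ →ₗ[ℂ] Matrix b b ℂ) : ℝ :=
  sSup (chiPotValues N)

/-- The potential quantum capacity `Q^{(p)}(N) = sup_M (Q^{(1)}(N ⊗ M) - Q^{(1)}(M))`. -/
def qPot {a b : Type*} [Fintype a] [DecidableEq a] [Fintype b] [DecidableEq b]
    (N : Matrix a a ℂ →ₗ[ℂ] Matrix b b ℂ) : ℝ :=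
  sSup (qPotValues N)

/-- The potential private capacity `P^{(p)}(N) = sup_M (P^{(1)}(N ⊗ M) - P^{(1)}(M))`. -/
def pPot {a b : Type*} [Fintype a] [DecidableEq a] [Fintype b] [DecidableEq b]
    (N : Matrix a a ℂ →ₗ[ℂ] Matrix b b ℂ) : ℝ :=
  sSup (pPotValues N)

end

end QChannel

set_option linter.unusedSectionVars false

open scoped Kronecker ComplexOrder

/-! Everything rests on one inequality: the coherent information I_c(A⟩B) = D(ω^{AB} ‖ 1 ⊗ ω^B) is a
convex function of the state (`coherentInfo_convexComb_le`), because relative entropy is jointly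
convex. Joint convexity comes from writing D(A‖B) as tr A - tr B plus an integral over [0,1] of
quadratic forms, each of which is a supremum of functionals real-linear in the pair (A, B). Singular
states are reached by adding ε • 1 and letting ε tend to 0.

For a fixed input the output is affine in the channel, so I_c is convex in the channel, and so is
I(X;B) = H(X) + I_c(X⟩B), since H(X) does not see the channel. In I(X;B) - I(X;E) the minus sign is
removed by purifying the input with a system R: the state on XBER is pure, hence I_c(X⟩E) =
-I_c(X⟩BR), and the difference equals I_c(X⟩B) + I_c(X⟩BR) (`IsStinespring.mutualInfo_sub`), two
convex terms free of the environment. Suprema of convex functions are convex. The potential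
quantities inherit this because N ⊗ M is affine in N and the subtracted term does not depend on N.

Finiteness needs bounds uniform in the auxiliary systems. Klein's inequality and a purification give
|H(B) - H(AB)| ≤ dim A (`abs_coherentInfo_le`). Hence discarding the systems of N from N ⊗ M changes
each quantity by at most a constant depending only on the dimensions of N. -/

namespace QChannel

/-! ### Relative entropy: integral representation, joint convexity, Klein's inequality. -/

section RelativeEntropy

open Matrix

variable {n : Type*} [Fintype n] [DecidableEq n]

/-- `A = U diag(r) Uᴴ` with `U` unitary. -/
def IsDiagonalizedBy (A U : Matrix n n ℂ) (r : n → ℝ) : Prop :=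
  Uᴴ * U = 1 ∧ A = U * diagonal (fun i => (r i : ℂ)) * Uᴴ

/-- The relative entropy of `U diag(r) Uᴴ` and `W diag(s) Wᴴ`. -/
noncomputable def relEntropy (U : Matrix n n ℂ) (r : n → ℝ) (W : Matrix n n ℂ) (s : n → ℝ) : ℝ :=
  ∑ i, ∑ j, ‖(Wᴴ * U) i j‖ ^ 2 * (r j * (Real.log (r j) - Real.log (s i)))

/-- The quadratic form occurring in the integral representation of the relative entropy. -/
noncomputable def relQuad (U : Matrix n n ℂ) (r : n → ℝ) (W : Matrix n n ℂ) (s : n → ℝ)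
    (u : ℝ) : ℝ :=
  ∑ i, ∑ j, ‖(Wᴴ * U) i j‖ ^ 2 * ((s i - r j) ^ 2 / ((1 - u) * r j + u * s i))

/-- The affine functionals whose supremum is `relQuad`. -/
noncomputable def relAffine (u : ℝ) (Y A B : Matrix n n ℂ) : ℝ :=
  2 * (Yᴴ * (A - B)).trace.re - (1 - u) * (Y * A * Yᴴ).trace.re - u * (Yᴴ * B * Y).trace.re

theorem convexComb_pos {r s u : ℝ} (hr : 0 < r) (hs : 0 < s) (hu : u ∈ Set.Icc (0 : ℝ) 1) :
    0 < (1 - u) * r + u * s := by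
  rcases eq_or_lt_of_le hu.1 with h | h
  · subst h; simpa using hr
  · have := mul_pos h hs
    have := mul_nonneg (sub_nonneg.2 hu.2) hr.le
    linarith

theorem continuousOn_quad {r s : ℝ} (hr : 0 < r) (hs : 0 < s) :
    ContinuousOn (fun u : ℝ => u * ((s - r) ^ 2 / ((1 - u) * r + u * s))) (Set.Icc 0 1) :=
  continuousOn_id.mul (continuousOn_const.div (by fun_prop)
    fun _ hu => (convexComb_pos hr hs hu).ne')

theorem intervalIntegrable_quad {r s : ℝ} (hr : 0 < r) (hs : 0 < s) :
    IntervalIntegrable (fun u : ℝ => u * ((s - r) ^ 2 / ((1 - u) * r + u * s)))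
      MeasureTheory.volume 0 1 :=
  ContinuousOn.intervalIntegrable (by
    rw [Set.uIcc_of_le zero_le_one]; exact continuousOn_quad hr hs)

/-- The expansion is chosen so that, for fixed `u`, the integrand is a square of a linear form in
`(r, s)` over a positive linear form, which is the shape that is jointly convex. -/
theorem mul_log_sub_log_eq_integral {r s : ℝ} (hr : 0 < r) (hs : 0 < s) :
    r * (Real.log r - Real.log s) =
      r - s + ∫ u in (0 : ℝ)..1, u * ((s - r) ^ 2 / ((1 - u) * r + u * s)) := by
  have h := intervalIntegral.integral_eq_sub_of_hasDerivAt
    (f := fun u : ℝ => (s - r) * u - r * Real.log ((1 - u) * r + u * s))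
    (f' := fun u : ℝ => u * ((s - r) ^ 2 / ((1 - u) * r + u * s))) (a := 0) (b := 1) ?_
    (intervalIntegrable_quad hr hs)
  · rw [h]; simp; ring
  · intro u hu
    rw [Set.uIcc_of_le zero_le_one] at hu
    have hp := convexComb_pos hr hs hu
    have h1 : HasDerivAt (fun u : ℝ => (1 - u) * r + u * s) (s - r) u := by
      have := (((hasDerivAt_id u).const_sub 1).mul_const r).add ((hasDerivAt_id u).mul_const s)
      refine this.congr_deriv ?_
      ring
    have h2 := ((hasDerivAt_id u).const_mul (s - r)).sub ((h1.log hp.ne').const_mul r)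
    refine h2.congr_deriv ?_
    rw [mul_one, eq_comm, mul_div_assoc', mul_div_assoc', div_eq_iff hp.ne', sub_mul,
      div_mul_cancel₀ _ hp.ne']
    ring

theorem sum_norm_sq_col {C : Matrix n n ℂ} (h : Cᴴ * C = 1) (j : n) : ∑ i, ‖C i j‖ ^ 2 = 1 := by
  have := congrFun (congrFun h j) j
  simp only [mul_apply, conjTranspose_apply, one_apply_eq, RCLike.star_def, Complex.conj_mul'] at this
  exact_mod_cast this

theorem sum_norm_sq_row {C : Matrix n n ℂ} (h : C * Cᴴ = 1) (i : n) : ∑ j, ‖C i j‖ ^ 2 = 1 := by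
  have := congrFun (congrFun h i) i
  simp only [mul_apply, conjTranspose_apply, one_apply_eq, RCLike.star_def, Complex.mul_conj'] at this
  exact_mod_cast this

variable {A B U W : Matrix n n ℂ} {r s : n → ℝ}

theorem IsDiagonalizedBy.trace (hA : IsDiagonalizedBy A U r) : A.trace.re = ∑ i, r i := by
  rw [hA.2, trace_mul_cycle, hA.1, one_mul, trace_diagonal]
  simp

theorem IsDiagonalizedBy.overlap (hA : IsDiagonalizedBy A U r) (hB : IsDiagonalizedBy B W s) :
    (Wᴴ * U)ᴴ * (Wᴴ * U) = 1 ∧ (Wᴴ * U) * (Wᴴ * U)ᴴ = 1 := by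
  have h1 := mul_eq_one_comm.1 hA.1
  have h2 := mul_eq_one_comm.1 hB.1
  have : (Wᴴ * U)ᴴ * (Wᴴ * U) = 1 := by
    simp only [conjTranspose_mul, conjTranspose_conjTranspose]
    rw [Matrix.mul_assoc, ← Matrix.mul_assoc W, h2, one_mul, hA.1]
  exact ⟨this, mul_eq_one_comm.1 this⟩

/-- The scalar formula is summed against the weights `‖(Wᴴ * U) i j‖ ^ 2`. These are doubly
stochastic, so the terms `r - s` add up to the difference of traces. -/
theorem relEntropy_eq_integral (hA : IsDiagonalizedBy A U r) (hB : IsDiagonalizedBy B W s)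
    (hr : ∀ i, 0 < r i) (hs : ∀ i, 0 < s i) :
    relEntropy U r W s = A.trace.re - B.trace.re + ∫ u in (0 : ℝ)..1, u * relQuad U r W s u := by
  obtain ⟨hC, hC'⟩ := hA.overlap hB
  have hint : (∫ u in (0 : ℝ)..1, u * relQuad U r W s u) = ∑ i, ∑ j, ‖(Wᴴ * U) i j‖ ^ 2 *
      ∫ u in (0 : ℝ)..1, u * ((s i - r j) ^ 2 / ((1 - u) * r j + u * s i)) := by
    have : (fun u : ℝ => u * relQuad U r W s u) = fun u => ∑ i, ∑ j, ‖(Wᴴ * U) i j‖ ^ 2 *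
        (u * ((s i - r j) ^ 2 / ((1 - u) * r j + u * s i))) := by
      funext u
      simp only [relQuad, Finset.mul_sum]
      refine Finset.sum_congr rfl fun i _ => Finset.sum_congr rfl fun j _ => by ring
    rw [this, intervalIntegral.integral_finsetSum]
    · refine Finset.sum_congr rfl fun i _ => ?_
      rw [intervalIntegral.integral_finsetSum]
      · simp
      · exact fun j _ => (intervalIntegrable_quad (hr j) (hs i)).const_mul _
    · intro i _
      rw [← Finset.sum_fn]
      exact IntervalIntegrable.sum _ fun j _ => (intervalIntegrable_quad (hr j) (hs i)).const_mul _
  have hA' : A.trace.re = ∑ i, ∑ j, ‖(Wᴴ * U) i j‖ ^ 2 * r j := by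
    rw [hA.trace, Finset.sum_comm]
    simp [← Finset.sum_mul, sum_norm_sq_col hC]
  have hB' : B.trace.re = ∑ i, ∑ j, ‖(Wᴴ * U) i j‖ ^ 2 * s i := by
    rw [hB.trace]
    simp [← Finset.sum_mul, sum_norm_sq_row hC']
  rw [hint, hA', hB', relEntropy]
  simp only [← Finset.sum_sub_distrib, ← Finset.sum_add_distrib]
  refine Finset.sum_congr rfl fun i _ => Finset.sum_congr rfl fun j _ => ?_
  rw [mul_log_sub_log_eq_integral (hr j) (hs i)]
  ring

theorem intervalIntegrable_relQuad (hr : ∀ i, 0 < r i) (hs : ∀ i, 0 < s i) :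
    IntervalIntegrable (fun u : ℝ => u * relQuad U r W s u) MeasureTheory.volume 0 1 := by
  refine ContinuousOn.intervalIntegrable ?_
  rw [Set.uIcc_of_le zero_le_one]
  refine continuousOn_id.mul ?_
  refine continuousOn_finsetSum _ fun i _ => continuousOn_finsetSum _ fun j _ => ?_
  exact continuousOn_const.mul (continuousOn_const.div (by fun_prop)
    fun _ hu => (convexComb_pos (hr j) (hs i) hu).ne')

/-- `relAffine` in terms of the entries of `Z = Wᴴ Y U`. -/
theorem relAffine_eq (hA : IsDiagonalizedBy A U r) (hB : IsDiagonalizedBy B W s) (u : ℝ)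
    (Z : Matrix n n ℂ) :
    relAffine u (W * Z * Uᴴ) A B = ∑ i, ∑ j,
      (2 * (star (Z i j) * ((Wᴴ * U) i j * ((r j - s i : ℝ) : ℂ))).re -
        ((1 - u) * r j + u * s i) * ‖Z i j‖ ^ 2) := by
  have hU := hA.1
  have hW := hB.1
  have h1 : ((W * Z * Uᴴ)ᴴ * (A - B)).trace =
      ∑ i, ∑ j, star (Z i j) * ((Wᴴ * U) i j * ((r j - s i : ℝ) : ℂ)) := by
    have : ((W * Z * Uᴴ)ᴴ * (A - B)).trace = (Zᴴ * (Wᴴ * (A - B) * U)).trace := by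
      simp only [conjTranspose_mul, conjTranspose_conjTranspose]
      rw [Matrix.mul_assoc U, trace_mul_comm U]
      simp only [Matrix.mul_assoc]
    have h2 : Wᴴ * (A - B) * U = (Wᴴ * U) * diagonal (fun i => (r i : ℂ)) -
        diagonal (fun i => (s i : ℂ)) * (Wᴴ * U) := by
      rw [hA.2, hB.2, Matrix.mul_sub, Matrix.sub_mul]
      congr 1
      · simp only [Matrix.mul_assoc, hU, Matrix.mul_one]
      · simp only [← Matrix.mul_assoc, hW, Matrix.one_mul]
    rw [this, h2, Matrix.trace, Finset.sum_comm]
    simp only [diag_apply, Matrix.mul_apply (M := Zᴴ), conjTranspose_apply, Matrix.sub_apply, mul_diagonal,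
      diagonal_mul]
    refine Finset.sum_congr rfl fun j _ => Finset.sum_congr rfl fun i _ => ?_
    push_cast
    ring
  have h3 : (W * Z * Uᴴ * A * (W * Z * Uᴴ)ᴴ).trace.re = ∑ i, ∑ j, r j * ‖Z i j‖ ^ 2 := by
    have : (W * Z * Uᴴ * A * (W * Z * Uᴴ)ᴴ).trace =
        (Z * diagonal (fun i => (r i : ℂ)) * Zᴴ).trace := by
      rw [hA.2]
      simp only [conjTranspose_mul, conjTranspose_conjTranspose, Matrix.mul_assoc]
      rw [trace_mul_comm W]
      simp only [Matrix.mul_assoc, hW, Matrix.mul_one]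
      simp only [← Matrix.mul_assoc Uᴴ, hU, Matrix.one_mul]
    rw [this]
    simp only [Matrix.trace, diag_apply, Matrix.mul_apply (N := Zᴴ), mul_diagonal, conjTranspose_apply,
      Complex.re_sum]
    refine Finset.sum_congr rfl fun i _ => Finset.sum_congr rfl fun j _ => ?_
    rw [mul_right_comm, RCLike.star_def, Complex.mul_conj']
    norm_cast
    ring
  have h4 : ((W * Z * Uᴴ)ᴴ * B * (W * Z * Uᴴ)).trace.re = ∑ i, ∑ j, s i * ‖Z i j‖ ^ 2 := by
    have : ((W * Z * Uᴴ)ᴴ * B * (W * Z * Uᴴ)).trace =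
        (Zᴴ * diagonal (fun i => (s i : ℂ)) * Z).trace := by
      rw [hB.2]
      simp only [conjTranspose_mul, conjTranspose_conjTranspose, Matrix.mul_assoc]
      rw [trace_mul_comm U]
      simp only [Matrix.mul_assoc, hU, Matrix.mul_one]
      simp only [← Matrix.mul_assoc Wᴴ, hW, Matrix.one_mul]
    rw [this, Finset.sum_comm]
    simp only [Matrix.trace, diag_apply, Matrix.mul_apply (N := Z), mul_diagonal, conjTranspose_apply,
      Complex.re_sum]
    refine Finset.sum_congr rfl fun i _ => Finset.sum_congr rfl fun j _ => ?_
    rw [mul_right_comm, RCLike.star_def, Complex.conj_mul']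
    norm_cast
    ring
  rw [relAffine, h1, h3, h4]
  simp only [Complex.re_sum, Finset.mul_sum, ← Finset.sum_sub_distrib]
  refine Finset.sum_congr rfl fun i _ => Finset.sum_congr rfl fun j _ => ?_
  ring

/-- Completing the square entry by entry: for an entry `z` of `Wᴴ Y U`, overlap `c` and denominator
`d`, the slack is at least `(‖c‖ |s - r| - d ‖z‖)² / d`. -/
theorem relAffine_le_relQuad (hA : IsDiagonalizedBy A U r) (hB : IsDiagonalizedBy B W s)
    (hr : ∀ i, 0 < r i) (hs : ∀ i, 0 < s i) {u : ℝ} (hu : u ∈ Set.Icc (0 : ℝ) 1)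
    (Y : Matrix n n ℂ) : relAffine u Y A B ≤ relQuad U r W s u := by
  have hY : Y = W * (Wᴴ * Y * U) * Uᴴ := by
    have h1 := mul_eq_one_comm.1 hA.1
    have h2 := mul_eq_one_comm.1 hB.1
    simp only [Matrix.mul_assoc, h1, Matrix.mul_one]
    rw [← Matrix.mul_assoc, h2, Matrix.one_mul]
  rw [hY, relAffine_eq hA hB, relQuad]
  refine Finset.sum_le_sum fun i _ => Finset.sum_le_sum fun j _ => ?_
  generalize (Wᴴ * Y * U) i j = z
  generalize (Wᴴ * U) i j = c
  have hd := convexComb_pos (hr j) (hs i) hu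
  set d := (1 - u) * r j + u * s i
  have h1 : (star z * (c * ((r j - s i : ℝ) : ℂ))).re ≤ ‖z‖ * (‖c‖ * |s i - r j|) := by
    refine (Complex.re_le_norm _).trans (le_of_eq ?_)
    rw [norm_mul, norm_mul, norm_star, Complex.norm_real, Real.norm_eq_abs, abs_sub_comm]
  have h2 : ‖c‖ ^ 2 * ((s i - r j) ^ 2 / d) - (2 * (‖z‖ * (‖c‖ * |s i - r j|)) - d * ‖z‖ ^ 2) =
      (‖c‖ * |s i - r j| - d * ‖z‖) ^ 2 / d := by
    rw [← sq_abs (s i - r j)]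
    field_simp
    ring
  have h3 : 0 ≤ (‖c‖ * |s i - r j| - d * ‖z‖) ^ 2 / d := by positivity
  linarith

theorem exists_relAffine_eq (hA : IsDiagonalizedBy A U r) (hB : IsDiagonalizedBy B W s)
    (hr : ∀ i, 0 < r i) (hs : ∀ i, 0 < s i) {u : ℝ} (hu : u ∈ Set.Icc (0 : ℝ) 1) :
    ∃ Y, relAffine u Y A B = relQuad U r W s u := by
  -- Each entry is the maximiser `c (r - s) / d` of `2 Re(conj z · c (r - s)) - d ‖z‖²`.
  refine ⟨W * (Matrix.of fun i j =>
    (Wᴴ * U) i j * (((r j - s i) / ((1 - u) * r j + u * s i) : ℝ) : ℂ)) * Uᴴ, ?_⟩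
  rw [relAffine_eq hA hB, relQuad]
  refine Finset.sum_congr rfl fun i _ => Finset.sum_congr rfl fun j _ => ?_
  simp only [of_apply]
  generalize (Wᴴ * U) i j = c
  have hd := convexComb_pos (hr j) (hs i) hu
  set d := (1 - u) * r j + u * s i
  have h1 : star (c * (((r j - s i) / d : ℝ) : ℂ)) * (c * ((r j - s i : ℝ) : ℂ)) =
      ((‖c‖ ^ 2 * ((r j - s i) / d * (r j - s i)) : ℝ) : ℂ) := by
    rw [star_mul', RCLike.star_def, Complex.conj_ofReal, mul_mul_mul_comm,
      Complex.conj_mul']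
    push_cast
    rfl
  rw [h1, Complex.ofReal_re, norm_mul, Complex.norm_real, Real.norm_eq_abs, mul_pow, sq_abs]
  field_simp
  ring

/-- For fixed `Y` the functional is real-linear in the pair `(A, B)`; this is the source of joint
convexity. -/
theorem relAffine_convexComb (u : ℝ) (Y A₁ A₂ B₁ B₂ : Matrix n n ℂ) (c d : ℝ) :
    relAffine u Y (c • A₁ + d • A₂) (c • B₁ + d • B₂) =
      c * relAffine u Y A₁ B₁ + d * relAffine u Y A₂ B₂ := by
  simp only [relAffine, Matrix.mul_add, Matrix.add_mul, Matrix.mul_smul, Matrix.smul_mul,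
    Matrix.mul_sub, trace_sub, trace_add, trace_smul, Complex.add_re, Complex.sub_re,
    Complex.smul_re, smul_eq_mul]
  ring

/-- Joint convexity of the relative entropy. -/
theorem relEntropy_convexComb_le {A₁ A₂ B₁ B₂ U₁ U₂ W₁ W₂ : Matrix n n ℂ} {r₁ r₂ s₁ s₂ : n → ℝ}
    {c d : ℝ} (hc : 0 ≤ c) (hd : 0 ≤ d)
    (hA : IsDiagonalizedBy (c • A₁ + d • A₂) U r) (hB : IsDiagonalizedBy (c • B₁ + d • B₂) W s)
    (hA₁ : IsDiagonalizedBy A₁ U₁ r₁) (hB₁ : IsDiagonalizedBy B₁ W₁ s₁)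
    (hA₂ : IsDiagonalizedBy A₂ U₂ r₂) (hB₂ : IsDiagonalizedBy B₂ W₂ s₂)
    (hr : ∀ i, 0 < r i) (hs : ∀ i, 0 < s i) (hr₁ : ∀ i, 0 < r₁ i) (hs₁ : ∀ i, 0 < s₁ i)
    (hr₂ : ∀ i, 0 < r₂ i) (hs₂ : ∀ i, 0 < s₂ i) :
    relEntropy U r W s ≤ c * relEntropy U₁ r₁ W₁ s₁ + d * relEntropy U₂ r₂ W₂ s₂ := by
  rw [relEntropy_eq_integral hA hB hr hs, relEntropy_eq_integral hA₁ hB₁ hr₁ hs₁,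
    relEntropy_eq_integral hA₂ hB₂ hr₂ hs₂]
  have hint : (∫ u in (0 : ℝ)..1, u * relQuad U r W s u) ≤
      ∫ u in (0 : ℝ)..1, (c * (u * relQuad U₁ r₁ W₁ s₁ u) + d * (u * relQuad U₂ r₂ W₂ s₂ u)) := by
    refine intervalIntegral.integral_mono_on zero_le_one (intervalIntegrable_relQuad hr hs)
      (((intervalIntegrable_relQuad hr₁ hs₁).const_mul c).add
        ((intervalIntegrable_relQuad hr₂ hs₂).const_mul d)) fun u hu => ?_
    -- The `Y` optimal for the mixture competes in the suprema of both components.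
    obtain ⟨Y, hY⟩ := exists_relAffine_eq hA hB hr hs hu
    rw [← hY, relAffine_convexComb]
    have h1 := mul_le_mul_of_nonneg_left
      (mul_le_mul_of_nonneg_left (relAffine_le_relQuad hA₁ hB₁ hr₁ hs₁ hu Y) hc) hu.1
    have h2 := mul_le_mul_of_nonneg_left
      (mul_le_mul_of_nonneg_left (relAffine_le_relQuad hA₂ hB₂ hr₂ hs₂ hu Y) hd) hu.1
    linarith
  rw [intervalIntegral.integral_add ((intervalIntegrable_relQuad hr₁ hs₁).const_mul c)
    ((intervalIntegrable_relQuad hr₂ hs₂).const_mul d), intervalIntegral.integral_const_mul,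
    intervalIntegral.integral_const_mul] at hint
  simp only [trace_add, trace_smul, Complex.add_re, Complex.smul_re, smul_eq_mul]
  linarith

/-- Klein's inequality. -/
theorem trace_sub_trace_le_relEntropy (hA : IsDiagonalizedBy A U r) (hB : IsDiagonalizedBy B W s)
    (hr : ∀ i, 0 < r i) (hs : ∀ i, 0 < s i) :
    A.trace.re - B.trace.re ≤ relEntropy U r W s := by
  rw [relEntropy_eq_integral hA hB hr hs]
  have : 0 ≤ ∫ u in (0 : ℝ)..1, u * relQuad U r W s u := by
    refine intervalIntegral.integral_nonneg zero_le_one fun u hu => mul_nonneg hu.1 ?_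
    refine Finset.sum_nonneg fun i _ => Finset.sum_nonneg fun j _ => ?_
    have := convexComb_pos (hr j) (hs i) hu
    positivity
  linarith

end RelativeEntropy

/-! ### Entropy and the convexity of coherent information. -/

section Entropy

open Matrix Filter Topology

variable {m n : Type*} [Fintype m] [DecidableEq m] [Fintype n] [DecidableEq n]

/-- Spectral invariances of the entropy thereby reduce to identities between characteristic
polynomials. -/
theorem entropy_eq_sum_roots {A : Matrix n n ℂ} (hA : A.IsHermitian) :
    entropy A = (A.charpoly.roots.map fun z => Real.negMulLog z.re).sum := by
  rw [entropy_eq_sum hA, hA.roots_charpoly_eq_eigenvalues]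
  simp

theorem IsDiagonalizedBy.isHermitian {A U : Matrix n n ℂ} {r : n → ℝ}
    (h : IsDiagonalizedBy A U r) : A.IsHermitian := by
  rw [h.2]
  refine isHermitian_mul_mul_conjTranspose _ ?_
  simp [IsHermitian, diagonal_conjTranspose, Pi.star_def]

theorem IsDiagonalizedBy.entropy {A U : Matrix n n ℂ} {r : n → ℝ}
    (h : IsDiagonalizedBy A U r) : entropy A = ∑ i, Real.negMulLog (r i) := by
  rw [entropy_eq_sum_roots h.isHermitian, h.2, charpoly_mul_comm, ← Matrix.mul_assoc, h.1,
    Matrix.one_mul, charpoly_diagonal, Polynomial.roots_prod _ _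
      (Finset.prod_ne_zero_iff.2 fun i _ => Polynomial.X_sub_C_ne_zero _)]
  simp

theorem _root_.Matrix.PosSemidef.exists_isDiagonalizedBy {A : Matrix n n ℂ} (hA : A.PosSemidef) :
    ∃ U r, IsDiagonalizedBy A U r ∧ ∀ i, 0 ≤ r i := by
  refine ⟨hA.1.eigenvectorUnitary, hA.1.eigenvalues, ⟨?_, ?_⟩, hA.eigenvalues_nonneg⟩
  · exact Unitary.coe_star_mul_self _
  · conv_lhs => rw [hA.1.spectral_theorem, Unitary.conjStarAlgAut_apply]
    rfl

theorem IsDiagonalizedBy.add_smul_one {A U : Matrix n n ℂ} {r : n → ℝ}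
    (h : IsDiagonalizedBy A U r) (ε : ℝ) :
    IsDiagonalizedBy (A + ε • 1) U (fun i => r i + ε) := by
  refine ⟨h.1, ?_⟩
  have h1 : diagonal (fun i => ((r i + ε : ℝ) : ℂ)) =
      diagonal (fun i => (r i : ℂ)) + ε • (1 : Matrix n n ℂ) := by
    ext i j
    by_cases hij : i = j
    · subst hij; simp
    · simp [hij]
  rw [h1, Matrix.mul_add, Matrix.add_mul, ← h.2, Matrix.mul_smul, Matrix.smul_mul, Matrix.mul_one,
    mul_eq_one_comm.1 h.1]

theorem traceFst_eq_sum (ω : Matrix (m × n) (m × n) ℂ) :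
    traceFst ω = ∑ i, ω.submatrix (Prod.mk i) (Prod.mk i) := by
  ext j j'
  simp [traceFst, Matrix.sum_apply]

theorem _root_.Matrix.PosSemidef.traceFst {ω : Matrix (m × n) (m × n) ℂ} (h : ω.PosSemidef) :
    (traceFst ω).PosSemidef := by
  rw [traceFst_eq_sum]
  exact posSemidef_sum _ fun i _ => h.submatrix _

theorem trace_traceFst (ω : Matrix (m × n) (m × n) ℂ) : (traceFst ω).trace = ω.trace := by
  simp [traceFst, Matrix.trace, Fintype.sum_prod_type_right]

theorem traceFst_one : traceFst (1 : Matrix (m × n) (m × n) ℂ) = (Fintype.card m : ℝ) • 1 := by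
  ext i j
  by_cases h : i = j
  · subst h; simp [traceFst]
  · simp [traceFst, h]

theorem traceFst_smul_real (c : ℝ) (ω : Matrix (m × n) (m × n) ℂ) :
    traceFst (c • ω) = c • traceFst ω := by
  ext i j
  simp [traceFst, Finset.mul_sum]

theorem traceFst_one_kronecker_mul_mul (W V : Matrix n n ℂ) (ω : Matrix (m × n) (m × n) ℂ) :
    traceFst ((1 ⊗ₖ W) * ω * (1 ⊗ₖ V)) = W * traceFst ω * V := by
  ext i j
  simp only [traceFst, Matrix.mul_apply, Fintype.sum_prod_type, kroneckerMap_apply, one_apply,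
    LinearMap.coe_mk, AddHom.coe_mk, of_apply, ite_mul, one_mul, zero_mul, mul_ite, mul_zero,
    Finset.sum_ite_irrel, Finset.sum_const_zero, Finset.sum_ite_eq, Finset.sum_ite_eq',
    Finset.mem_univ, if_true, Finset.mul_sum, Finset.sum_mul]
  rw [Finset.sum_comm]
  refine Finset.sum_congr rfl fun x _ => ?_
  rw [Finset.sum_comm]

theorem IsDiagonalizedBy.one_kronecker {B W : Matrix n n ℂ} {s : n → ℝ}
    (h : IsDiagonalizedBy B W s) :
    IsDiagonalizedBy ((1 : Matrix m m ℂ) ⊗ₖ B) (1 ⊗ₖ W) (fun p => s p.2) := by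
  refine ⟨?_, ?_⟩
  · rw [conjTranspose_kronecker, ← mul_kronecker_mul, h.1]
    simp
  · have : diagonal (fun p : m × n => (s p.2 : ℂ)) =
        (1 : Matrix m m ℂ) ⊗ₖ diagonal (fun i => (s i : ℂ)) := by
      ext ⟨a, i⟩ ⟨b, j⟩
      by_cases h1 : a = b <;> by_cases h2 : i = j <;> simp [h1, h2]
    rw [this, conjTranspose_kronecker, ← mul_kronecker_mul, ← mul_kronecker_mul, ← h.2]
    simp

theorem IsDiagonalizedBy.sum_overlap {A U : Matrix n n ℂ} {r : n → ℝ}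
    (h : IsDiagonalizedBy A U r) (V : Matrix n n ℂ) (i : n) :
    ∑ j, ‖(Vᴴ * U) i j‖ ^ 2 * r j = ((Vᴴ * A * V) i i).re := by
  have : Vᴴ * A * V = (Vᴴ * U) * diagonal (fun i => (r i : ℂ)) * (Vᴴ * U)ᴴ := by
    rw [h.2]
    simp only [conjTranspose_mul, conjTranspose_conjTranspose, Matrix.mul_assoc]
  rw [this]
  generalize Vᴴ * U = C
  simp only [Matrix.mul_apply (N := Cᴴ), mul_diagonal, conjTranspose_apply, Complex.re_sum]
  refine Finset.sum_congr rfl fun j _ => ?_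
  rw [mul_right_comm, RCLike.star_def, Complex.mul_conj']
  norm_cast

/-- This is I_c(A⟩B) = D(ω ‖ 1 ⊗ ω^B), which holds because tr ω log(1 ⊗ ω^B) = tr ω^B log ω^B. No
positivity of the eigenvalues is needed. -/
theorem coherentInfo_eq_relEntropy {ω U : Matrix (m × n) (m × n) ℂ} {r : m × n → ℝ}
    {W : Matrix n n ℂ} {s : n → ℝ} (hω : IsDiagonalizedBy ω U r)
    (hB : IsDiagonalizedBy (traceFst ω) W s) :
    coherentInfo ω = relEntropy U r (1 ⊗ₖ W) (fun p => s p.2) := by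
  have hV := hB.one_kronecker (m := m)
  obtain ⟨hC, hC'⟩ := hω.overlap hV
  have h1 : ∑ p : m × n, ∑ q, ‖(((1 : Matrix m m ℂ) ⊗ₖ W)ᴴ * U) p q‖ ^ 2 *
      (r q * Real.log (r q)) = - entropy ω := by
    rw [hω.entropy, Finset.sum_comm]
    simp only [← Finset.sum_mul, sum_norm_sq_col hC, Real.negMulLog]
    simp
  have h2 : ∑ p : m × n, Real.log (s p.2) * ∑ q, ‖(((1 : Matrix m m ℂ) ⊗ₖ W)ᴴ * U) p q‖ ^ 2 * r q
      = - entropy (traceFst ω) := by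
    simp only [hω.sum_overlap]
    -- In the eigenbasis of the marginal, summing the diagonal of `ω` over the first system gives
    -- the eigenvalues of the marginal.
    have h3 : ∀ i, ∑ x : m,
        ((((1 : Matrix m m ℂ) ⊗ₖ W)ᴴ * ω * ((1 : Matrix m m ℂ) ⊗ₖ W)) (x, i) (x, i)).re = s i := by
      intro i
      have := congrFun (congrFun (traceFst_one_kronecker_mul_mul Wᴴ W ω) i) i
      have h4 : Wᴴ * traceFst ω * W = diagonal (fun i => (s i : ℂ)) := by
        rw [hB.2]
        simp only [Matrix.mul_assoc, hB.1, Matrix.mul_one]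
        rw [← Matrix.mul_assoc, hB.1, Matrix.one_mul]
      rw [h4, diagonal_apply_eq] at this
      rw [conjTranspose_kronecker, conjTranspose_one, ← Complex.re_sum]
      exact (congrArg Complex.re this).trans (Complex.ofReal_re _)
    rw [Fintype.sum_prod_type_right, hB.entropy]
    simp only [← Finset.mul_sum, h3, Real.negMulLog]
    simp [mul_comm]
  rw [coherentInfo, relEntropy, ← neg_eq_iff_eq_neg.2 h2, ← neg_eq_iff_eq_neg.2 h1]
  simp only [Finset.mul_sum, sub_neg_eq_add]
  rw [neg_add_eq_sub, ← Finset.sum_sub_distrib]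
  refine Finset.sum_congr rfl fun p _ => ?_
  rw [← Finset.sum_sub_distrib]
  refine Finset.sum_congr rfl fun q _ => ?_
  ring

/-- The factor `c` serves the marginal: tracing out a system of dimension `c` turns `ε • 1` into `(ε
* c) • 1`. -/
theorem tendsto_entropy_add_smul_one {A : Matrix n n ℂ} (hA : A.PosSemidef) (c : ℝ) :
    Tendsto (fun ε : ℝ => entropy (A + (ε * c) • 1)) (𝓝[>] 0) (𝓝 (entropy A)) := by
  obtain ⟨U, r, h, -⟩ := hA.exists_isDiagonalizedBy
  have h1 : (fun ε : ℝ => entropy (A + (ε * c) • 1)) =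
      fun ε => ∑ i, Real.negMulLog (r i + ε * c) :=
    funext fun ε => (h.add_smul_one _).entropy
  rw [h1, h.entropy]
  have h2 : Continuous fun ε : ℝ => ∑ i, Real.negMulLog (r i + ε * c) :=
    continuous_finsetSum _ fun i _ => Real.continuous_negMulLog.comp (by fun_prop)
  have h3 := h2.tendsto 0
  simp only [zero_mul, add_zero] at h3
  exact h3.mono_left nhdsWithin_le_nhds

theorem traceFst_add_smul_one (ω : Matrix (m × n) (m × n) ℂ) (ε : ℝ) :
    traceFst (ω + ε • 1) = traceFst ω + (ε * Fintype.card m) • 1 := by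
  rw [map_add, traceFst_smul_real, traceFst_one, smul_smul]

theorem tendsto_coherentInfo_add_smul_one {ω : Matrix (m × n) (m × n) ℂ} (h : ω.PosSemidef) :
    Tendsto (fun ε : ℝ => coherentInfo (ω + ε • 1)) (𝓝[>] 0) (𝓝 (coherentInfo ω)) := by
  have h1 := (tendsto_entropy_add_smul_one h.traceFst (Fintype.card m)).sub
    (tendsto_entropy_add_smul_one h 1)
  simpa only [coherentInfo, traceFst_add_smul_one, mul_one] using h1

/-- Diagonalizations of `ω + ε` and of its marginal, with positive eigenvalues. -/
theorem exists_isDiagonalizedBy_add_smul_one [Nonempty m] {ω : Matrix (m × n) (m × n) ℂ}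
    (h : ω.PosSemidef) {ε : ℝ} (hε : 0 < ε) :
    ∃ U r W s, IsDiagonalizedBy (ω + ε • 1) U r ∧ IsDiagonalizedBy (traceFst (ω + ε • 1)) W s ∧
      (∀ i, 0 < r i) ∧ ∀ i, 0 < s i := by
  obtain ⟨U, r, hU, hr⟩ := h.exists_isDiagonalizedBy
  obtain ⟨W, s, hW, hs⟩ := h.traceFst.exists_isDiagonalizedBy
  have hm : (0 : ℝ) < Fintype.card m := by exact_mod_cast Fintype.card_pos
  refine ⟨U, _, W, fun i => s i + ε * Fintype.card m, hU.add_smul_one ε, ?_, fun i => ?_,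
    fun i => ?_⟩
  · rw [traceFst_add_smul_one]
    exact hW.add_smul_one _
  · have := hr i; positivity
  · have := hs i; positivity

/-- Convexity of the coherent information (concavity of the conditional entropy), which is
equivalent to strong subadditivity. -/
theorem coherentInfo_convexComb_le [Nonempty m] {ω₁ ω₂ : Matrix (m × n) (m × n) ℂ}
    (h₁ : ω₁.PosSemidef) (h₂ : ω₂.PosSemidef) {c d : ℝ} (hc : 0 ≤ c) (hd : 0 ≤ d)
    (hcd : c + d = 1) :
    coherentInfo (c • ω₁ + d • ω₂) ≤ c * coherentInfo ω₁ + d * coherentInfo ω₂ := by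
  have h : (c • ω₁ + d • ω₂).PosSemidef := (h₁.smul hc).add (h₂.smul hd)
  refine le_of_tendsto_of_tendsto (tendsto_coherentInfo_add_smul_one h)
    (((tendsto_coherentInfo_add_smul_one h₁).const_mul c).add
      ((tendsto_coherentInfo_add_smul_one h₂).const_mul d)) ?_
  filter_upwards [self_mem_nhdsWithin] with ε hε
  obtain ⟨U, r, W, s, hU, hW, hr, hs⟩ := exists_isDiagonalizedBy_add_smul_one h hε
  obtain ⟨U₁, r₁, W₁, s₁, hU₁, hW₁, hr₁, hs₁⟩ := exists_isDiagonalizedBy_add_smul_one h₁ hε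
  obtain ⟨U₂, r₂, W₂, s₂, hU₂, hW₂, hr₂, hs₂⟩ := exists_isDiagonalizedBy_add_smul_one h₂ hε
  have e : c • ω₁ + d • ω₂ + ε • (1 : Matrix (m × n) (m × n) ℂ) =
      c • (ω₁ + ε • 1) + d • (ω₂ + ε • 1) := by
    rw [smul_add, smul_add, add_add_add_comm, ← add_smul, hcd, one_smul]
  rw [coherentInfo_eq_relEntropy hU hW, coherentInfo_eq_relEntropy hU₁ hW₁,
    coherentInfo_eq_relEntropy hU₂ hW₂]
  refine relEntropy_convexComb_le hc hd (e ▸ hU) ?_ hU₁ hW₁.one_kronecker hU₂ hW₂.one_kronecker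
    hr (fun i => hs _) hr₁ (fun i => hs₁ _) hr₂ (fun i => hs₂ _)
  have := hW.one_kronecker (m := m)
  rwa [e, map_add, traceFst_smul_real, traceFst_smul_real, kronecker_add, kronecker_smul,
    kronecker_smul] at this

/-- Klein's inequality for `ω` against `1 ⊗ ω^B`, whose trace is the dimension of the first system.
The bound is cruder than the logarithmic one, but only finiteness is at stake. -/
theorem coherentInfo_ge [Nonempty m] {ω : Matrix (m × n) (m × n) ℂ} (h : IsState ω) :
    1 - (Fintype.card m : ℝ) ≤ coherentInfo ω := by
  have hlim : Tendsto (fun ε : ℝ => (ω + ε • 1).trace.re -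
      ((1 : Matrix m m ℂ) ⊗ₖ traceFst (ω + ε • 1)).trace.re) (𝓝[>] 0)
      (𝓝 (1 - (Fintype.card m : ℝ))) := by
    have h1 : Continuous fun ε : ℝ => (ω + ε • 1).trace.re -
      ((1 : Matrix m m ℂ) ⊗ₖ traceFst (ω + ε • 1)).trace.re := by
      simp only [trace_kronecker, trace_traceFst, trace_add, trace_smul, trace_one]
      fun_prop
    have h2 := h1.tendsto 0
    simp only [zero_smul, add_zero, trace_kronecker, trace_traceFst, h.2, trace_one] at h2
    simp only [mul_one, Complex.one_re, Complex.natCast_re] at h2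
    simp only [trace_kronecker, trace_traceFst, trace_one]
    exact h2.mono_left nhdsWithin_le_nhds
  refine le_of_tendsto_of_tendsto hlim (tendsto_coherentInfo_add_smul_one h.1) ?_
  filter_upwards [self_mem_nhdsWithin] with ε hε
  obtain ⟨U, r, W, s, hU, hW, hr, hs⟩ := exists_isDiagonalizedBy_add_smul_one h.1 hε
  rw [coherentInfo_eq_relEntropy hU hW]
  exact trace_sub_trace_le_relEntropy hU hW.one_kronecker hr fun i => hs _

end Entropy

/-! ### Purification and dimension bounds. -/

section EntropyBounds

open Matrix

variable {m n r k d : Type*} [Fintype m] [DecidableEq m] [Fintype n] [DecidableEq n]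
  [Fintype r] [DecidableEq r] [Fintype k] [DecidableEq k] [Fintype d] [DecidableEq d]

/-- The two characteristic polynomials agree up to powers of `X`, and a zero eigenvalue contributes
`negMulLog 0 = 0`. -/
theorem entropy_mul_conjTranspose_self (L : Matrix m n ℂ) :
    entropy (L * Lᴴ) = entropy (Lᴴ * L) := by
  have h0 : ∀ (j : ℕ) (p : Polynomial ℂ), p ≠ 0 →
      ((Polynomial.X ^ j * p).roots.map fun z : ℂ => Real.negMulLog z.re).sum =
        (p.roots.map fun z : ℂ => Real.negMulLog z.re).sum := by
    intro j p hp
    rw [Polynomial.roots_mul (mul_ne_zero (pow_ne_zero _ Polynomial.X_ne_zero) hp)]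
    simp [Multiset.map_nsmul, Multiset.sum_nsmul]
  rw [entropy_eq_sum_roots (isHermitian_mul_conjTranspose_self L),
    entropy_eq_sum_roots (isHermitian_conjTranspose_mul_self L),
    ← h0 (Fintype.card n) _ (charpoly_monic _).ne_zero, charpoly_mul_comm',
    h0 _ _ (charpoly_monic _).ne_zero]

theorem entropy_transpose {A : Matrix n n ℂ} (hA : A.IsHermitian) : entropy Aᵀ = entropy A := by
  rw [entropy_eq_sum_roots hA, entropy_eq_sum_roots hA.transpose, charpoly_transpose]

/-- If `L` is the amplitude matrix of a pure bipartite state, the marginals are `L * Lᴴ` and `(Lᴴ *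
L)ᵀ`, so this is the equality of their entropies. -/
theorem entropy_mul_conjTranspose_self' (L : Matrix m n ℂ) :
    entropy (L * Lᴴ) = entropy (Lᴴ * L)ᵀ := by
  rw [entropy_transpose (isHermitian_conjTranspose_mul_self L), entropy_mul_conjTranspose_self]

theorem entropy_submatrix_equiv {A : Matrix n n ℂ} (hA : A.IsHermitian) (e : m ≃ n) :
    entropy (A.submatrix e e) = entropy A := by
  rw [entropy_eq_sum_roots hA, entropy_eq_sum_roots (hA.submatrix e)]
  have := charpoly_reindex e.symm A
  rw [reindex_apply, Equiv.symm_symm] at this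
  rw [this]

theorem _root_.Matrix.PosSemidef.exists_eq_mul_conjTranspose {A : Matrix n n ℂ}
    (hA : A.PosSemidef) : ∃ S : Matrix n n ℂ, A = S * Sᴴ := by
  obtain ⟨U, r, ⟨-, h⟩, hr⟩ := hA.exists_isDiagonalizedBy
  refine ⟨U * diagonal (fun i => (Real.sqrt (r i) : ℂ)), ?_⟩
  have h1 : diagonal (fun i => (r i : ℂ)) = diagonal (fun i => (Real.sqrt (r i) : ℂ)) *
      (diagonal (fun i => (Real.sqrt (r i) : ℂ)))ᴴ := by
    rw [diagonal_conjTranspose, diagonal_mul_diagonal]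
    congr 1
    funext i
    simp only [Pi.star_apply, RCLike.star_def, Complex.conj_ofReal]
    rw [← Complex.ofReal_mul, Real.mul_self_sqrt (hr i)]
  rw [h, h1, conjTranspose_mul]
  simp only [Matrix.mul_assoc]

theorem IsState.entropy_nonneg_and_le {A : Matrix n n ℂ} (hA : IsState A) :
    0 ≤ entropy A ∧ entropy A ≤ Fintype.card n := by
  obtain ⟨U, r, h, hr⟩ := hA.1.exists_isDiagonalizedBy
  have htr : ∑ i, r i = 1 := by rw [← h.trace, hA.2]; simp
  have hr1 : ∀ i, r i ≤ 1 := fun i => htr ▸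
    Finset.single_le_sum (f := r) (fun j _ => hr j) (Finset.mem_univ i)
  rw [h.entropy]
  refine ⟨Finset.sum_nonneg fun i _ => Real.negMulLog_nonneg (hr i) (hr1 i), ?_⟩
  have : ∀ i ∈ Finset.univ, Real.negMulLog (r i) ≤ 1 := by
    intro i _
    rcases eq_or_lt_of_le (hr i) with h0 | h0
    · rw [← h0]; simp
    · have h1 := Real.add_one_le_exp (-Real.log (r i))
      rw [Real.exp_neg, Real.exp_log h0] at h1
      have h2 := mul_le_mul_of_nonneg_left h1 h0.le
      rw [mul_inv_cancel₀ h0.ne'] at h2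
      rw [Real.negMulLog]
      nlinarith
  simpa using Finset.sum_le_sum this

theorem IsState.traceFst {ω : Matrix (m × n) (m × n) ℂ} (h : IsState ω) :
    IsState (traceFst ω) :=
  ⟨h.1.traceFst, by rw [trace_traceFst, h.2]⟩

theorem IsState.submatrix {A : Matrix n n ℂ} (h : IsState A) (e : m ≃ n) :
    IsState (A.submatrix e e) := by
  refine ⟨h.1.submatrix e, ?_⟩
  rw [← h.2]
  exact Equiv.sum_comp e fun i => A i i

theorem IsState.nonempty {A : Matrix n n ℂ} (h : IsState A) : Nonempty n := by
  by_contra hn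
  rw [not_nonempty_iff] at hn
  have := h.2
  simp [Matrix.trace] at this

/-- Tracing out a system changes the entropy by at most a constant depending on the dimension of
that system. -/
theorem abs_coherentInfo_le {ω : Matrix (m × n) (m × n) ℂ} (h : IsState ω) :
    |coherentInfo ω| ≤ Fintype.card m := by
  have : Nonempty m := h.nonempty.map Prod.fst
  rw [abs_le]
  refine ⟨by linarith [coherentInfo_ge h], ?_⟩
  obtain ⟨S, hS⟩ := h.1.exists_eq_mul_conjTranspose
  -- `L` is the amplitude matrix of a purification, cut as B against AR with R a copy of AB. Purity
  -- gives I_c(A⟩R) = -I_c(A⟩B), so the lower bound on AR is the missing upper bound.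
  set L : Matrix n (m × (m × n)) ℂ := of fun j p => S (p.1, j) p.2 with hL
  have h1 : QChannel.traceFst ω = L * Lᴴ := by
    ext i j
    simp [hL, hS, QChannel.traceFst, Matrix.mul_apply, Fintype.sum_prod_type]
  have h2 : QChannel.traceFst (Lᴴ * L)ᵀ = (Sᴴ * S)ᵀ := by
    ext i j
    simp only [hL, QChannel.traceFst, Matrix.mul_apply, LinearMap.coe_mk, AddHom.coe_mk, of_apply,
      transpose_apply, conjTranspose_apply]
    rw [Fintype.sum_prod_type]
  have h3 : IsState (Lᴴ * L)ᵀ := by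
    refine ⟨(posSemidef_conjTranspose_mul_self L).transpose, ?_⟩
    rw [trace_transpose, trace_mul_comm, ← h1, trace_traceFst, h.2]
  have h4 := coherentInfo_ge h3
  rw [coherentInfo, h2, ← entropy_mul_conjTranspose_self', ← entropy_mul_conjTranspose_self', ← h1,
    ← hS] at h4
  rw [coherentInfo]
  linarith

/-- The partial trace over the middle system, `ρ^{XAB} ↦ ρ^{XB}`. -/
def traceMid (ω : Matrix (k × (m × n)) (k × (m × n)) ℂ) : Matrix (k × n) (k × n) ℂ :=
  of fun p q => traceFst (of fun i j => ω (p.1, i) (q.1, j)) p.2 q.2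

/-- The equivalence moving the middle factor to the front. -/
def midEquiv (k m n : Type*) : m × (k × n) ≃ k × (m × n) where
  toFun p := (p.2.1, (p.1, p.2.2))
  invFun p := (p.2.1, (p.1, p.2.2))

theorem traceMid_eq_traceFst (ω : Matrix (k × (m × n)) (k × (m × n)) ℂ) :
    traceMid ω = traceFst (ω.submatrix (midEquiv k m n) (midEquiv k m n)) := rfl

theorem traceFst_traceMid (ω : Matrix (k × (m × n)) (k × (m × n)) ℂ) :
    traceFst (traceMid ω) = traceFst (traceFst ω) := by
  ext i j
  simp only [traceMid, traceFst, LinearMap.coe_mk, AddHom.coe_mk, of_apply]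
  rw [Finset.sum_comm]

theorem traceSnd_traceMid (ω : Matrix (k × (m × n)) (k × (m × n)) ℂ) :
    traceSnd (traceMid ω) = traceSnd ω := by
  ext i j
  simp only [traceMid, traceFst, traceSnd, LinearMap.coe_mk, AddHom.coe_mk, of_apply,
    Fintype.sum_prod_type_right]

theorem IsState.traceMid {ω : Matrix (k × (m × n)) (k × (m × n)) ℂ} (h : IsState ω) :
    IsState (traceMid ω) := by
  rw [traceMid_eq_traceFst]
  exact (h.submatrix _).traceFst

/-- For `ω` on XAB the difference is [H(B) - H(AB)] - [H(XB) - H(XAB)]; each bracket is the effect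
of tracing out A. The dimensions of X and B do not enter. -/
theorem abs_coherentInfo_traceMid_sub_le {ω : Matrix (k × (m × n)) (k × (m × n)) ℂ}
    (h : IsState ω) : |coherentInfo (traceMid ω) - coherentInfo ω| ≤ 2 * Fintype.card m := by
  have h1 := abs_coherentInfo_le h.traceFst
  have h2 := abs_coherentInfo_le (h.submatrix (midEquiv k m n))
  rw [coherentInfo, ← traceFst_traceMid] at h1
  rw [coherentInfo, ← traceMid_eq_traceFst, entropy_submatrix_equiv h.1.1] at h2
  rw [coherentInfo, coherentInfo]
  rw [abs_le] at h1 h2 ⊢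
  constructor <;> linarith

theorem coherentInfo_submatrix_equiv {ω : Matrix (k × n) (k × n) ℂ} (h : ω.PosSemidef)
    (e : m ≃ n) :
    coherentInfo (ω.submatrix (Prod.map id e) (Prod.map id e)) = coherentInfo ω := by
  have h1 := entropy_submatrix_equiv h.1 ((Equiv.refl k).prodCongr e)
  have h2 := entropy_submatrix_equiv h.traceFst.1 e
  rw [coherentInfo, coherentInfo, ← h1, ← h2]
  rfl

theorem mutualInfo_eq (ω : Matrix (k × n) (k × n) ℂ) :
    mutualInfo ω = entropy (traceSnd ω) + coherentInfo ω := by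
  rw [mutualInfo, coherentInfo, add_sub_assoc]

/-- Both H(B) and H(X) - H(XB) are controlled by the dimension of B alone, so the bound is uniform
in the alphabet X. -/
theorem abs_mutualInfo_le {ω : Matrix (k × n) (k × n) ℂ} (h : IsState ω) :
    |mutualInfo ω| ≤ 2 * Fintype.card n := by
  have h1 := abs_coherentInfo_le (h.submatrix (Equiv.prodComm n k))
  have h2 := h.traceFst.entropy_nonneg_and_le
  have h3 : QChannel.traceFst (ω.submatrix (Equiv.prodComm n k) (Equiv.prodComm n k)) =
    traceSnd ω := rfl
  rw [coherentInfo, h3, entropy_submatrix_equiv h.1.1] at h1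
  rw [mutualInfo]
  rw [abs_le] at h1 ⊢
  constructor <;> linarith

theorem coherentInfo_le {ω : Matrix (k × n) (k × n) ℂ} (h : IsState ω) :
    coherentInfo ω ≤ Fintype.card n := by
  have h1 := h.traceFst.entropy_nonneg_and_le
  have h2 := h.entropy_nonneg_and_le
  rw [coherentInfo]
  linarith

end EntropyBounds

/-! ### Stinespring dilations, tensor products and the purified output. -/

section Channels

open Matrix

variable {a b c d k r : Type*} [Fintype a] [DecidableEq a] [Fintype b] [DecidableEq b]
  [Fintype c] [DecidableEq c] [Fintype d] [DecidableEq d] [Fintype k] [DecidableEq k]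
  [Fintype r] [DecidableEq r]

/-- The block of row `x` of a rectangular matrix. -/
def rowBlock (S : Matrix (k × a) r ℂ) (x : k) : Matrix a r ℂ := of fun i j => S (x, i) j

theorem block_mul_conjTranspose (S : Matrix (k × a) r ℂ) (x y : k) :
    (of fun i j => (S * Sᴴ) (x, i) (y, j)) = rowBlock S x * (rowBlock S y)ᴴ := rfl

theorem mul_mul_mul_mul_conjTranspose {l m n o p : Type*} [Fintype l] [Fintype m] [Fintype n]
    [Fintype o] [Fintype p] (V : Matrix l m ℂ) (A : Matrix m n ℂ) (B : Matrix p n ℂ)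
    (W : Matrix o p ℂ) : V * (A * Bᴴ) * Wᴴ = (V * A) * (W * B)ᴴ := by
  simp only [conjTranspose_mul, Matrix.mul_assoc]

section Stinespring

variable {e : ℕ} {N : Matrix a a ℂ →ₗ[ℂ] Matrix b b ℂ} {V : Matrix (b × Fin e) a ℂ}

theorem trace_traceSnd (ω : Matrix (a × b) (a × b) ℂ) : (traceSnd ω).trace = ω.trace := by
  simp [traceSnd, Matrix.trace, Fintype.sum_prod_type]

theorem IsStinespring.trace_map (h : IsStinespring N V) (ρ : Matrix a a ℂ) :
    (N ρ).trace = ρ.trace := by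
  rw [h.2, trace_traceSnd, trace_mul_comm, ← Matrix.mul_assoc, h.1, Matrix.one_mul]

theorem IsStinespring.trace_complementary (h : IsStinespring N V) (ρ : Matrix a a ℂ) :
    (complementary V ρ).trace = ρ.trace := by
  change (traceFst (V * ρ * Vᴴ)).trace = _
  rw [trace_traceFst, trace_mul_comm, ← Matrix.mul_assoc, h.1, Matrix.one_mul]

theorem IsStinespring.tensorMap_id_mul_conjTranspose (h : IsStinespring N V)
    (S : Matrix (k × a) r ℂ) :
    ∃ K : Matrix (k × b) (Fin e × r) ℂ, tensorMap LinearMap.id N (S * Sᴴ) = K * Kᴴ := by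
  refine ⟨of fun p q => (V * rowBlock S p.1) (p.2, q.1) q.2, ?_⟩
  ext ⟨x, i⟩ ⟨y, j⟩
  rw [tensorMap_id_apply, block_mul_conjTranspose, h.2, mul_mul_mul_mul_conjTranspose]
  simp only [traceSnd, LinearMap.coe_mk, AddHom.coe_mk, of_apply, Matrix.mul_apply (N := _ᴴ),
    conjTranspose_apply, Fintype.sum_prod_type]

theorem IsStinespring.posSemidef (h : IsStinespring N V) {ρ : Matrix (k × a) (k × a) ℂ}
    (hρ : ρ.PosSemidef) : (tensorMap LinearMap.id N ρ).PosSemidef := by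
  obtain ⟨S, rfl⟩ := hρ.exists_eq_mul_conjTranspose
  obtain ⟨K, hK⟩ := h.tensorMap_id_mul_conjTranspose S
  rw [hK]
  exact posSemidef_self_mul_conjTranspose K

theorem IsStinespring.isChannel (h : IsStinespring N V) : IsChannel N :=
  ⟨(isCompletelyPositive_iff N).2 fun _ _ hρ => h.posSemidef hρ, h.trace_map⟩

theorem linearMap_ext_single {X : Type*} [AddCommMonoid X] [Module ℂ X]
    {f g : Matrix a a ℂ →ₗ[ℂ] X} (h : ∀ i j, f (single i j 1) = g (single i j 1)) : f = g := by
  refine ext_linearMap _ fun i j => LinearMap.ext_ring ?_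
  simpa using h i j

/-- Conjugation by `V` followed by the partial trace over the second factor. -/
noncomputable def traceSndConj {e : Type*} [Fintype e] (V : Matrix (b × e) a ℂ) :
    Matrix a a ℂ →ₗ[ℂ] Matrix b b ℂ where
  toFun ρ := traceSnd (V * ρ * Vᴴ)
  map_add' ρ σ := by simp [Matrix.mul_add, Matrix.add_mul]
  map_smul' c ρ := by simp

theorem traceSndConj_single {e : Type*} [Fintype e] (V : Matrix (b × e) a ℂ) (i j : a) (p q : b) :
    traceSndConj V (single i j 1) p q = ∑ ε, V (p, ε) i * star (V (q, ε) j) := by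
  change ∑ ε, (V * single i j (1 : ℂ) * Vᴴ : Matrix (b × e) (b × e) ℂ) (p, ε) (q, ε) = _
  refine Finset.sum_congr rfl fun ε _ => ?_
  simp [Matrix.mul_apply, single_apply, ite_and]

/-- A Stinespring dilation may use any finite environment. -/
theorem exists_isStinespring_of_traceSndConj {e : Type*} [Fintype e] {V : Matrix (b × e) a ℂ}
    (hN : N = traceSndConj V) (htr : ∀ ρ, (N ρ).trace = ρ.trace) :
    ∃ (e' : ℕ) (V' : Matrix (b × Fin e') a ℂ), IsStinespring N V' := by
  let f := Fintype.equivFin e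
  refine ⟨Fintype.card e, of fun p i => V (p.1, f.symm p.2) i, ?_, ?_⟩
  · ext i j
    -- Trace preservation on matrix units says exactly that `Vᴴ * V` has the entries of the
    -- identity.
    have h1 := htr (single j i 1)
    rw [hN, Matrix.trace] at h1
    simp only [diag_apply, traceSndConj_single] at h1
    have h2 : (single j i (1 : ℂ)).trace = (1 : Matrix a a ℂ) i j := by
      by_cases hij : i = j
      · subst hij; simp
      · rw [one_apply_ne hij, trace_single_eq_of_ne _ _ _ (Ne.symm hij)]
    rw [h2] at h1
    rw [← h1]
    simp only [Matrix.mul_apply, conjTranspose_apply, of_apply, Fintype.sum_prod_type]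
    refine Finset.sum_congr rfl fun p _ => ?_
    rw [Equiv.sum_comp f.symm fun ε => star (V (p, ε) i) * V (p, ε) j]
    exact Finset.sum_congr rfl fun ε _ => mul_comm _ _
  · intro ρ
    rw [hN]
    ext p q
    simp only [traceSndConj, traceSnd, LinearMap.coe_mk, AddHom.coe_mk, of_apply]
    exact (Equiv.sum_comp f.symm fun ε => (V * ρ * Vᴴ) (p, ε) (q, ε)).symm

end Stinespring

/-- Every channel has a Stinespring dilation. -/
theorem IsChannel.exists_isStinespring {N : Matrix a a ℂ →ₗ[ℂ] Matrix b b ℂ} (h : IsChannel N) :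
    ∃ (e : ℕ) (V : Matrix (b × Fin e) a ℂ), IsStinespring N V := by
  let f := Fintype.equivFin a
  -- `w` is the unnormalised maximally entangled vector, so the matrix factored below is the Choi
  -- matrix of `N`; its factor `K`, reindexed, is the dilation.
  let w : Fin (Fintype.card a) × a → ℂ := fun p => if p.1 = f p.2 then 1 else 0
  have h1 := (isCompletelyPositive_iff N).1 h.1 (Fintype.card a) _
    (posSemidef_vecMulVec_self_star w)
  obtain ⟨K, hK⟩ := h1.exists_eq_mul_conjTranspose
  refine exists_isStinespring_of_traceSndConj (V := of fun p i => K (f i, p.1) p.2) ?_ h.2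
  refine linearMap_ext_single fun i j => ?_
  ext p q
  have h2 := congrFun (congrFun hK (f i, p)) (f j, q)
  rw [tensorMap_id_apply] at h2
  have h3 : (of fun i' j' => vecMulVec w (star w) (f i, i') (f j, j')) = single i j 1 := by
    ext i' j'
    simp only [of_apply, vecMulVec_apply, Pi.star_apply, w, single_apply, f.apply_eq_iff_eq]
    by_cases hi : i = i' <;> by_cases hj : j = j' <;> simp [hi, hj]
  rw [h3] at h2
  rw [h2, traceSndConj_single]
  rfl

theorem tensorMap_single_single (N : Matrix a a ℂ →ₗ[ℂ] Matrix b b ℂ)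
    (M : Matrix c c ℂ →ₗ[ℂ] Matrix d d ℂ) (i i' : a) (j j' : c) :
    tensorMap N M (single (i, j) (i', j') 1) = N (single i i' 1) ⊗ₖ M (single j j' 1) := by
  rw [← tensorMap_kronecker, single_kronecker_single, one_mul]

theorem IsChannel.trace_tensorMap {N : Matrix a a ℂ →ₗ[ℂ] Matrix b b ℂ}
    {M : Matrix c c ℂ →ₗ[ℂ] Matrix d d ℂ} (hN : ∀ ρ, (N ρ).trace = ρ.trace)
    (hM : ∀ ρ, (M ρ).trace = ρ.trace) (ρ : Matrix (a × c) (a × c) ℂ) :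
    (tensorMap N M ρ).trace = ρ.trace := by
  have : traceLinearMap (b × d) ℂ ℂ ∘ₗ tensorMap N M = traceLinearMap (a × c) ℂ ℂ := by
    refine linearMap_ext_single fun p q => ?_
    obtain ⟨i, j⟩ := p
    obtain ⟨i', j'⟩ := q
    simp only [LinearMap.comp_apply, tensorMap_single_single, traceLinearMap_apply,
      trace_kronecker, hN, hM]
    rw [← trace_kronecker, single_kronecker_single, one_mul]
  exact LinearMap.congr_fun this ρ

/-- The product of two Stinespring dilations, with the environments paired, dilates the tensor
product; complete positivity is read off from it. -/
theorem IsChannel.tensor {N : Matrix a a ℂ →ₗ[ℂ] Matrix b b ℂ}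
    {M : Matrix c c ℂ →ₗ[ℂ] Matrix d d ℂ} (hN : IsChannel N) (hM : IsChannel M) :
    IsChannel (tensorMap N M) := by
  obtain ⟨e₁, V, hV⟩ := hN.exists_isStinespring
  obtain ⟨e₂, W, hW⟩ := hM.exists_isStinespring
  have key : QChannel.tensorMap N M = traceSndConj
      (of fun (p : (b × d) × (Fin e₁ × Fin e₂)) (q : a × c) =>
        V (p.1.1, p.2.1) q.1 * W (p.1.2, p.2.2) q.2) := by
    refine linearMap_ext_single fun p q => ?_
    obtain ⟨i, j⟩ := p
    obtain ⟨i', j'⟩ := q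
    have hN' : N = traceSndConj V := LinearMap.ext hV.2
    have hM' : M = traceSndConj W := LinearMap.ext hW.2
    ext ⟨x, y⟩ ⟨x', y'⟩
    rw [tensorMap_single_single, kroneckerMap_apply, hN', hM', traceSndConj_single,
      traceSndConj_single, traceSndConj_single, Finset.sum_mul_sum, Fintype.sum_prod_type]
    refine Finset.sum_congr rfl fun ε _ => Finset.sum_congr rfl fun ε' _ => ?_
    simp only [of_apply, star_mul']
    ring
  obtain ⟨e, V', hV'⟩ := exists_isStinespring_of_traceSndConj key
    (IsChannel.trace_tensorMap hN.2 hM.2)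
  exact hV'.isChannel

theorem traceFst_kronecker (A : Matrix a a ℂ) (B : Matrix b b ℂ) :
    traceFst (A ⊗ₖ B) = A.trace • B := by
  ext i j
  simp [traceFst, Matrix.trace, Finset.sum_mul]

/-- Discarding the output of a trace preserving map amounts to discarding its input; matrix units
suffice. -/
theorem traceFst_tensorMap {N : Matrix a a ℂ →ₗ[ℂ] Matrix b b ℂ}
    (hN : ∀ ρ, (N ρ).trace = ρ.trace) (M : Matrix c c ℂ →ₗ[ℂ] Matrix d d ℂ)
    (ρ : Matrix (a × c) (a × c) ℂ) : traceFst (tensorMap N M ρ) = M (traceFst ρ) := by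
  have : traceFst ∘ₗ tensorMap N M = M ∘ₗ traceFst := by
    refine linearMap_ext_single fun p q => ?_
    obtain ⟨i, j⟩ := p
    obtain ⟨i', j'⟩ := q
    rw [LinearMap.comp_apply, LinearMap.comp_apply, tensorMap_single_single,
      traceFst_kronecker, hN, ← map_smul, ← traceFst_kronecker, single_kronecker_single, one_mul]
  exact LinearMap.congr_fun this ρ

theorem traceMid_tensorMap {N : Matrix a a ℂ →ₗ[ℂ] Matrix b b ℂ}
    (hN : ∀ ρ, (N ρ).trace = ρ.trace) (M : Matrix c c ℂ →ₗ[ℂ] Matrix d d ℂ)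
    (ρ : Matrix (k × (a × c)) (k × (a × c)) ℂ) :
    traceMid (tensorMap LinearMap.id (tensorMap N M) ρ) =
      tensorMap LinearMap.id M (traceMid ρ) := by
  ext ⟨x, i⟩ ⟨y, j⟩
  rw [tensorMap_id_apply]
  change traceFst (of fun i' j' => tensorMap LinearMap.id (tensorMap N M) ρ (x, i') (y, j')) i j =
    M (traceFst (of fun i' j' => ρ (x, i') (y, j'))) i j
  rw [← traceFst_tensorMap hN]
  simp only [tensorMap_id_apply]
  rfl

theorem traceSnd_tensorMap_id {N : Matrix a a ℂ →ₗ[ℂ] Matrix b b ℂ}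
    (hN : ∀ ρ, (N ρ).trace = ρ.trace) (ρ : Matrix (k × a) (k × a) ℂ) :
    traceSnd (tensorMap LinearMap.id N ρ) = traceSnd ρ := by
  ext x y
  change ∑ j, tensorMap LinearMap.id N ρ (x, j) (y, j) = ∑ j, ρ (x, j) (y, j)
  simp only [tensorMap_id_apply]
  exact hN _

theorem IsChannel.isState {N : Matrix a a ℂ →ₗ[ℂ] Matrix b b ℂ} (h : IsChannel N)
    {ρ : Matrix (k × a) (k × a) ℂ} (hρ : IsState ρ) :
    IsState (QChannel.tensorMap LinearMap.id N ρ) := by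
  obtain ⟨e, V, hV⟩ := h.exists_isStinespring
  refine ⟨hV.posSemidef hρ.1, ?_⟩
  rw [← trace_traceSnd, traceSnd_tensorMap_id h.2, trace_traceSnd, hρ.2]

theorem tensorMap_id_convexComb (N M : Matrix a a ℂ →ₗ[ℂ] Matrix b b ℂ) (s t : ℝ)
    (ρ : Matrix (k × a) (k × a) ℂ) :
    tensorMap LinearMap.id (s • N + t • M) ρ =
      s • tensorMap LinearMap.id N ρ + t • tensorMap LinearMap.id M ρ := by
  ext ⟨x, i⟩ ⟨y, j⟩
  simp only [tensorMap_id_apply, Matrix.add_apply, Matrix.smul_apply, LinearMap.add_apply,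
    LinearMap.smul_apply]

theorem tensorMap_convexComb_left (N N' : Matrix a a ℂ →ₗ[ℂ] Matrix b b ℂ)
    (M : Matrix c c ℂ →ₗ[ℂ] Matrix d d ℂ) (s t : ℝ) :
    tensorMap (s • N + t • N') M = s • tensorMap N M + t • tensorMap N' M := by
  refine linearMap_ext_single fun p q => ?_
  obtain ⟨i, j⟩ := p
  obtain ⟨i', j'⟩ := q
  simp only [LinearMap.add_apply, LinearMap.smul_apply, tensorMap_single_single, add_kronecker,
    smul_kronecker]

theorem convex_channels : Convex ℝ (channels a b) := by
  intro N hN M hM s t hs ht hst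
  refine ⟨(isCompletelyPositive_iff _).2 fun k ρ hρ => ?_, fun ρ => ?_⟩
  · rw [tensorMap_id_convexComb]
    exact (((isCompletelyPositive_iff _).1 hN.1 k ρ hρ).smul hs).add
      (((isCompletelyPositive_iff _).1 hM.1 k ρ hρ).smul ht)
  · rw [LinearMap.add_apply, LinearMap.smul_apply, LinearMap.smul_apply, trace_add, trace_smul,
      trace_smul, hN.2, hM.2, ← add_smul, hst, one_smul]

/-- The output on `X(BR)` of the channel applied to the pure state with vector `S` on `X A R`. -/
def purifiedOutput (N : Matrix a a ℂ →ₗ[ℂ] Matrix b b ℂ) (S : Matrix (k × a) r ℂ) :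
    Matrix (k × (b × r)) (k × (b × r)) ℂ :=
  of fun p q => N (vecMulVec (fun i => S (p.1, i) p.2.2) (star fun i => S (q.1, i) q.2.2))
    p.2.1 q.2.1

/-- Linearity in the channel is the gain over the complementary output, which depends on a choice of
isometry. -/
theorem purifiedOutput_convexComb (N M : Matrix a a ℂ →ₗ[ℂ] Matrix b b ℂ) (s t : ℝ)
    (S : Matrix (k × a) r ℂ) :
    purifiedOutput (s • N + t • M) S = s • purifiedOutput N S + t • purifiedOutput M S := rfl

theorem IsStinespring.purifiedOutput_apply {e : ℕ} {N : Matrix a a ℂ →ₗ[ℂ] Matrix b b ℂ}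
    {V : Matrix (b × Fin e) a ℂ} (h : IsStinespring N V) (S : Matrix (k × a) r ℂ)
    (p q : k × (b × r)) :
    purifiedOutput N S p q = ∑ ε, (V * rowBlock S p.1) (p.2.1, ε) p.2.2 *
      star ((V * rowBlock S q.1) (q.2.1, ε) q.2.2) := by
  change N _ _ _ = _
  rw [h.2, mul_vecMulVec, vecMulVec_mul, ← star_mulVec]
  rfl

theorem IsChannel.isState_purifiedOutput {N : Matrix a a ℂ →ₗ[ℂ] Matrix b b ℂ}
    (h : IsChannel N) {S : Matrix (k × a) r ℂ} (hS : IsState (S * Sᴴ)) :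
    IsState (purifiedOutput N S) := by
  obtain ⟨e, V, hV⟩ := h.exists_isStinespring
  constructor
  · have : purifiedOutput N S =
        (of fun (p : k × (b × r)) ε => (V * rowBlock S p.1) (p.2.1, ε) p.2.2) *
        (of fun (p : k × (b × r)) ε => (V * rowBlock S p.1) (p.2.1, ε) p.2.2)ᴴ := by
      ext p q
      rw [hV.purifiedOutput_apply]
      rfl
    rw [this]
    exact posSemidef_self_mul_conjTranspose _
  · rw [← hS.2]
    simp only [Matrix.trace, diag_apply, Fintype.sum_prod_type, purifiedOutput, of_apply]
    refine Finset.sum_congr rfl fun x _ => ?_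
    rw [Finset.sum_comm]
    have h1 : ∀ j : r, ∑ y, N (vecMulVec (fun i => S (x, i) j) (star fun i => S (x, i) j)) y y =
        ∑ i, S (x, i) j * star (S (x, i) j) := fun j => h.2 _
    simp only [h1]
    rw [Finset.sum_comm]
    rfl

theorem tensorMap_id_complementary_apply {e : ℕ} (V : Matrix (b × Fin e) a ℂ)
    (S : Matrix (k × a) r ℂ) (p q : k × Fin e) :
    tensorMap LinearMap.id (complementary V) (S * Sᴴ) p q =
      ∑ y, ∑ j, (V * rowBlock S p.1) (y, p.2) j * star ((V * rowBlock S q.1) (y, q.2) j) := by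
  obtain ⟨x, i⟩ := p
  obtain ⟨y, j⟩ := q
  rw [tensorMap_id_apply, block_mul_conjTranspose]
  change traceFst (V * _ * Vᴴ) i j = _
  rw [mul_mul_mul_mul_conjTranspose]
  rfl

theorem IsStinespring.isState_complementary {e : ℕ} {N : Matrix a a ℂ →ₗ[ℂ] Matrix b b ℂ}
    {V : Matrix (b × Fin e) a ℂ} (h : IsStinespring N V) {S : Matrix (k × a) r ℂ}
    (hS : IsState (S * Sᴴ)) :
    IsState (tensorMap LinearMap.id (complementary V) (S * Sᴴ)) := by
  constructor
  · have : tensorMap LinearMap.id (complementary V) (S * Sᴴ) =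
        (of fun (p : k × Fin e) (q : b × r) => (V * rowBlock S p.1) (q.1, p.2) q.2) *
        (of fun (p : k × Fin e) (q : b × r) => (V * rowBlock S p.1) (q.1, p.2) q.2)ᴴ := by
      ext p q
      rw [tensorMap_id_complementary_apply, Matrix.mul_apply, Fintype.sum_prod_type]
      rfl
    rw [this]
    exact posSemidef_self_mul_conjTranspose _
  · rw [← trace_traceSnd, traceSnd_tensorMap_id h.trace_complementary, trace_traceSnd, hS.2]

/-- The complementary output is replaced by the purified output: `I_c(X⟩E) = -I_c(X⟩BR)`. -/
theorem IsStinespring.coherentInfo_complementary {e : ℕ} {N : Matrix a a ℂ →ₗ[ℂ] Matrix b b ℂ}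
    {V : Matrix (b × Fin e) a ℂ} (h : IsStinespring N V) (S : Matrix (k × a) r ℂ) :
    coherentInfo (tensorMap LinearMap.id (complementary V) (S * Sᴴ)) =
      -coherentInfo (purifiedOutput N S) := by
  -- `T` is the amplitude of the pure state on XBER. Cutting it as XE against BR gives `h1`, and as
  -- E against XBR gives `h2`.
  set T : k → b → Fin e → r → ℂ := fun x y ε j => (V * rowBlock S x) (y, ε) j with hT
  have hE : ∀ p q, tensorMap LinearMap.id (complementary V) (S * Sᴴ) p q =
      ∑ y, ∑ j, T p.1 y p.2 j * star (T q.1 y q.2 j) := tensorMap_id_complementary_apply V S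
  have hB : ∀ p q, purifiedOutput N S p q =
      ∑ ε, T p.1 p.2.1 ε p.2.2 * star (T q.1 q.2.1 ε q.2.2) := h.purifiedOutput_apply S
  have h1 : entropy (tensorMap LinearMap.id (complementary V) (S * Sᴴ)) =
      entropy (traceFst (purifiedOutput N S)) := by
    set L : Matrix (k × Fin e) (b × r) ℂ := of fun p q => T p.1 q.1 p.2 q.2 with hL
    have e1 : tensorMap LinearMap.id (complementary V) (S * Sᴴ) = L * Lᴴ := by
      ext p q
      rw [hE, Matrix.mul_apply, Fintype.sum_prod_type]
      rfl
    have e2 : traceFst (purifiedOutput N S) = (Lᴴ * L)ᵀ := by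
      ext p q
      change ∑ x, purifiedOutput N S (x, p) (x, q) = (Lᴴ * L) q p
      rw [Matrix.mul_apply, Fintype.sum_prod_type]
      simp only [hB]
      exact Finset.sum_congr rfl fun x _ => Finset.sum_congr rfl fun ε _ => mul_comm _ _
    rw [e1, e2, entropy_mul_conjTranspose_self']
  have h2 : entropy (traceFst (tensorMap LinearMap.id (complementary V) (S * Sᴴ))) =
      entropy (purifiedOutput N S) := by
    set L : Matrix (k × (b × r)) (Fin e) ℂ := of fun p ε => T p.1 p.2.1 ε p.2.2 with hL
    have e1 : purifiedOutput N S = L * Lᴴ := by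
      ext p q
      rw [hB]
      rfl
    have e2 : traceFst (tensorMap LinearMap.id (complementary V) (S * Sᴴ)) = (Lᴴ * L)ᵀ := by
      ext p q
      change ∑ x, tensorMap LinearMap.id (complementary V) (S * Sᴴ) (x, p) (x, q) = (Lᴴ * L) q p
      rw [Matrix.mul_apply, Fintype.sum_prod_type]
      simp only [hE, Fintype.sum_prod_type]
      exact Finset.sum_congr rfl fun x _ => Finset.sum_congr rfl fun y _ =>
        Finset.sum_congr rfl fun j _ => mul_comm _ _
    rw [e1, e2, entropy_mul_conjTranspose_self']
  rw [coherentInfo, coherentInfo, h1, h2]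
  ring

/-- H(X) is the same in both mutual informations and cancels. The right side no longer mentions `V`,
and both summands are convex in `N`. -/
theorem IsStinespring.mutualInfo_sub {e : ℕ} {N : Matrix a a ℂ →ₗ[ℂ] Matrix b b ℂ}
    {V : Matrix (b × Fin e) a ℂ} (h : IsStinespring N V) (S : Matrix (k × a) r ℂ) :
    mutualInfo (tensorMap LinearMap.id N (S * Sᴴ)) -
        mutualInfo (tensorMap LinearMap.id (complementary V) (S * Sᴴ)) =
      coherentInfo (tensorMap LinearMap.id N (S * Sᴴ)) + coherentInfo (purifiedOutput N S) := by
  rw [mutualInfo_eq, mutualInfo_eq, h.coherentInfo_complementary, traceSnd_tensorMap_id h.trace_map,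
    traceSnd_tensorMap_id h.trace_complementary]
  ring

end Channels

/-! ### Classical-quantum states. -/

section ClassicalQuantum

open Matrix

variable {a c : Type*} [Fintype a] [DecidableEq a] [Fintype c] [DecidableEq c] {k : ℕ}

theorem posSemidef_single_self {n : Type*} [Fintype n] [DecidableEq n] (x : n) :
    (single x x (1 : ℂ)).PosSemidef := by
  rw [← diagonal_single]
  refine PosSemidef.diagonal fun i => ?_
  by_cases h : i = x
  · subst h; simp
  · simp [h]

theorem IsClassicalQuantum.isState {ρ : Matrix (Fin k × a) (Fin k × a) ℂ}
    (h : IsClassicalQuantum ρ) : IsState ρ := by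
  obtain ⟨p, σ, hp, hp1, hσ, rfl⟩ := h
  refine ⟨posSemidef_sum _ fun x _ => ?_, ?_⟩
  · refine ((posSemidef_single_self x).kronecker (hσ x).1).smul ?_
    exact_mod_cast hp x
  · simp only [trace_sum, trace_smul, trace_kronecker, (hσ _).2, trace_single_eq_same]
    simp only [smul_eq_mul, mul_one]
    exact_mod_cast hp1

theorem IsClassicalQuantum.traceMid {ρ : Matrix (Fin k × (a × c)) (Fin k × (a × c)) ℂ}
    (h : IsClassicalQuantum ρ) : IsClassicalQuantum (traceMid ρ) := by
  obtain ⟨p, σ, hp, hp1, hσ, rfl⟩ := h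
  refine ⟨p, fun x => traceFst (σ x), hp, hp1, fun x => (hσ x).traceFst, ?_⟩
  ext ⟨x, i⟩ ⟨y, j⟩
  simp only [QChannel.traceMid, traceFst, LinearMap.coe_mk, AddHom.coe_mk, of_apply,
    Matrix.sum_apply, Matrix.smul_apply, kroneckerMap_apply, smul_eq_mul, Finset.mul_sum]
  rw [Finset.sum_comm]

theorem exists_isClassicalQuantum (a : Type*) [Fintype a] [DecidableEq a] [Nonempty a] :
    ∃ ρ : Matrix (Fin 1 × a) (Fin 1 × a) ℂ, IsClassicalQuantum ρ := by
  obtain ⟨i⟩ := ‹Nonempty a›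
  exact ⟨_, fun _ => 1, fun _ => single i i 1, fun _ => zero_le_one, by simp,
    fun _ => ⟨posSemidef_single_self i, trace_single_eq_same _ _⟩, rfl⟩

end ClassicalQuantum

/-! ### One-shot quantities: convexity, finiteness, and the cost of tensoring with a channel. -/

section OneShot

open Matrix

variable {a b c d : Type*} [Fintype a] [DecidableEq a] [Fintype b] [DecidableEq b]
  [Fintype c] [DecidableEq c] [Fintype d] [DecidableEq d]

/-- A supremum of value sets is convex if each value at a mixture is dominated by the mixture of
values. -/
theorem convexOn_sSup {F : (Matrix a a ℂ →ₗ[ℂ] Matrix b b ℂ) → Set ℝ}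
    (hne : ∀ N ∈ channels a b, (F N).Nonempty) (hbdd : ∀ N ∈ channels a b, BddAbove (F N))
    (h : ∀ N ∈ channels a b, ∀ M ∈ channels a b, ∀ s t : ℝ, 0 ≤ s → 0 ≤ t → s + t = 1 →
      ∀ x ∈ F (s • N + t • M), ∃ y ∈ F N, ∃ z ∈ F M, x ≤ s * y + t * z) :
    ConvexOn ℝ (channels a b) fun N => sSup (F N) := by
  refine ⟨convex_channels, fun N hN M hM s t hs ht hst => ?_⟩
  refine csSup_le (hne _ (convex_channels hN hM hs ht hst)) fun x hx => ?_
  obtain ⟨y, hy, z, hz, hxyz⟩ := h N hN M hM s t hs ht hst x hx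
  exact hxyz.trans (add_le_add (mul_le_mul_of_nonneg_left (le_csSup (hbdd N hN) hy) hs)
    (mul_le_mul_of_nonneg_left (le_csSup (hbdd M hM) hz) ht))

variable {N M : Matrix a a ℂ →ₗ[ℂ] Matrix b b ℂ}

theorem IsChannel.coherentInfo_convexComb_le {k : Type*} [Fintype k] [DecidableEq k]
    (hN : IsChannel N) (hM : IsChannel M) {s t : ℝ} (hs : 0 ≤ s) (ht : 0 ≤ t) (hst : s + t = 1)
    {ρ : Matrix (k × a) (k × a) ℂ} (hρ : IsState ρ) :
    coherentInfo (tensorMap LinearMap.id (s • N + t • M) ρ) ≤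
      s * coherentInfo (tensorMap LinearMap.id N ρ) +
        t * coherentInfo (tensorMap LinearMap.id M ρ) := by
  have : Nonempty k := hρ.nonempty.map Prod.fst
  rw [tensorMap_id_convexComb]
  exact QChannel.coherentInfo_convexComb_le (hN.isState hρ).1 (hM.isState hρ).1 hs ht hst

/-! ### Holevo information -/

theorem holevoValues_nonempty [Nonempty a] (N : Matrix a a ℂ →ₗ[ℂ] Matrix b b ℂ) :
    (holevoValues N).Nonempty := by
  obtain ⟨ρ, hρ⟩ := exists_isClassicalQuantum a
  exact ⟨_, 1, ρ, hρ, rfl⟩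

theorem IsChannel.bddAbove_holevoValues (hN : IsChannel N) : BddAbove (holevoValues N) := by
  refine ⟨2 * Fintype.card b, ?_⟩
  rintro _ ⟨k, ρ, hρ, rfl⟩
  exact (abs_le.1 (abs_mutualInfo_le (hN.isState hρ.isState))).2

theorem convexOn_chi [Nonempty a] : ConvexOn ℝ (channels a b) chi := by
  refine convexOn_sSup (fun N _ => holevoValues_nonempty N)
    (fun N hN => IsChannel.bddAbove_holevoValues hN) ?_
  rintro N hN M hM s t hs ht hst _ ⟨k, ρ, hρ, rfl⟩
  -- The same input state is admissible for both channels.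
  refine ⟨_, ⟨k, ρ, hρ, rfl⟩, _, ⟨k, ρ, hρ, rfl⟩, ?_⟩
  have h1 := IsChannel.coherentInfo_convexComb_le hN hM hs ht hst hρ.isState
  rw [mutualInfo_eq, mutualInfo_eq, mutualInfo_eq, traceSnd_tensorMap_id hN.2,
    traceSnd_tensorMap_id hM.2, traceSnd_tensorMap_id (convex_channels hN hM hs ht hst).2]
  have h2 : entropy (traceSnd ρ) = s * entropy (traceSnd ρ) + t * entropy (traceSnd ρ) := by
    rw [← add_mul, hst, one_mul]
  linarith

/-- Dropping the systems of `N` from an input of `N ⊗ M` leaves an admissible input of `M` with the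
same X marginal, at a cost in which `M` does not enter. -/
theorem chi_tensorMap_le [Nonempty a] [Nonempty c] (hN : IsChannel N)
    {M : Matrix c c ℂ →ₗ[ℂ] Matrix d d ℂ} (hM : IsChannel M) :
    chi (tensorMap N M) ≤ chi M + 2 * Fintype.card b := by
  refine csSup_le (holevoValues_nonempty _) ?_
  rintro _ ⟨k, ρ, hρ, rfl⟩
  have h1 := le_csSup hM.bddAbove_holevoValues ⟨k, _, hρ.traceMid, rfl⟩
  have hNM := hN.tensor hM
  have h2 := (abs_le.1 (abs_coherentInfo_traceMid_sub_le (hNM.isState hρ.isState))).1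
  rw [traceMid_tensorMap hN.2] at h2
  rw [mutualInfo_eq, traceSnd_tensorMap_id hM.2, traceSnd_traceMid] at h1
  rw [mutualInfo_eq, traceSnd_tensorMap_id hNM.2, chi]
  linarith

/-! ### Coherent information -/

theorem coherentValues_nonempty [Nonempty a] (N : Matrix a a ℂ →ₗ[ℂ] Matrix b b ℂ) :
    (coherentValues N).Nonempty := by
  obtain ⟨ρ, hρ⟩ := exists_isClassicalQuantum a
  exact ⟨_, 1, ρ, hρ.isState, rfl⟩

theorem IsChannel.bddAbove_coherentValues (hN : IsChannel N) : BddAbove (coherentValues N) := by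
  refine ⟨Fintype.card b, ?_⟩
  rintro _ ⟨k, ρ, hρ, rfl⟩
  exact coherentInfo_le (hN.isState hρ)

theorem convexOn_qOne [Nonempty a] : ConvexOn ℝ (channels a b) qOne := by
  refine convexOn_sSup (fun N _ => coherentValues_nonempty N)
    (fun N hN => IsChannel.bddAbove_coherentValues hN) ?_
  rintro N hN M hM s t hs ht hst _ ⟨k, ρ, hρ, rfl⟩
  exact ⟨_, ⟨k, ρ, hρ, rfl⟩, _, ⟨k, ρ, hρ, rfl⟩,
    IsChannel.coherentInfo_convexComb_le hN hM hs ht hst hρ⟩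

theorem qOne_tensorMap_le [Nonempty a] [Nonempty c] (hN : IsChannel N)
    {M : Matrix c c ℂ →ₗ[ℂ] Matrix d d ℂ} (hM : IsChannel M) :
    qOne (tensorMap N M) ≤ qOne M + 2 * Fintype.card b := by
  refine csSup_le (coherentValues_nonempty _) ?_
  rintro _ ⟨k, ρ, hρ, rfl⟩
  have h1 := le_csSup hM.bddAbove_coherentValues ⟨k, _, hρ.traceMid, rfl⟩
  have h2 := (abs_le.1 (abs_coherentInfo_traceMid_sub_le ((hN.tensor hM).isState hρ))).1
  rw [traceMid_tensorMap hN.2] at h2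
  rw [qOne]
  linarith

/-! ### Private information -/

/-- The purifying system `r` is left arbitrary because regrouping enlarges it by an input system. -/
theorem IsChannel.mem_privateValues (hN : IsChannel N) {k : ℕ} {r : Type*} [Fintype r]
    [DecidableEq r] {S : Matrix (Fin k × a) r ℂ} (hS : IsClassicalQuantum (S * Sᴴ)) :
    coherentInfo (tensorMap LinearMap.id N (S * Sᴴ)) + coherentInfo (purifiedOutput N S) ∈
      privateValues N := by
  obtain ⟨e, V, hV⟩ := hN.exists_isStinespring
  exact ⟨e, V, k, _, hV, hS, (hV.mutualInfo_sub S).symm⟩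

theorem exists_of_mem_privateValues {x : ℝ} (hx : x ∈ privateValues N) :
    ∃ (k : ℕ) (S : Matrix (Fin k × a) (Fin k × a) ℂ), IsClassicalQuantum (S * Sᴴ) ∧
      x = coherentInfo (tensorMap LinearMap.id N (S * Sᴴ)) +
        coherentInfo (purifiedOutput N S) := by
  obtain ⟨e, V, k, ρ, hV, hρ, rfl⟩ := hx
  obtain ⟨S, rfl⟩ := hρ.isState.1.exists_eq_mul_conjTranspose
  exact ⟨k, S, hρ, hV.mutualInfo_sub S⟩

theorem IsChannel.privateValues_nonempty [Nonempty a] (hN : IsChannel N) :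
    (privateValues N).Nonempty := by
  obtain ⟨ρ, hρ⟩ := exists_isClassicalQuantum a
  obtain ⟨e, V, hV⟩ := hN.exists_isStinespring
  exact ⟨_, e, V, 1, ρ, hV, hρ, rfl⟩

theorem IsChannel.bddAbove_privateValues (hN : IsChannel N) : BddAbove (privateValues N) := by
  obtain ⟨e, V, hV⟩ := hN.exists_isStinespring
  refine ⟨2 * Fintype.card b + 2 * e, ?_⟩
  intro x hx
  obtain ⟨k, S, hS, rfl⟩ := exists_of_mem_privateValues hx
  rw [← hV.mutualInfo_sub]
  have h1 := (abs_le.1 (abs_mutualInfo_le (hN.isState hS.isState))).2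
  have h2 := (abs_le.1 (abs_mutualInfo_le (hV.isState_complementary hS.isState))).1
  rw [Fintype.card_fin] at h2
  linarith

theorem convexOn_pOne [Nonempty a] : ConvexOn ℝ (channels a b) pOne := by
  refine convexOn_sSup (fun N hN => IsChannel.privateValues_nonempty hN)
    (fun N hN => IsChannel.bddAbove_privateValues hN) ?_
  rintro N hN M hM s t hs ht hst x hx
  obtain ⟨k, S, hS, rfl⟩ := exists_of_mem_privateValues hx
  refine ⟨_, IsChannel.mem_privateValues hN hS, _, IsChannel.mem_privateValues hM hS, ?_⟩
  have : Nonempty (Fin k) := hS.isState.nonempty.map Prod.fst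
  have h1 := IsChannel.coherentInfo_convexComb_le hN hM hs ht hst hS.isState
  have h2 := QChannel.coherentInfo_convexComb_le (IsChannel.isState_purifiedOutput hN hS.isState).1
    (IsChannel.isState_purifiedOutput hM hS.isState).1 hs ht hst
  rw [purifiedOutput_convexComb]
  linarith

/-- Regrouping of a purification: the first input system joins the purifying system. -/
def regroup {k r : Type*} (S : Matrix (k × (a × c)) r ℂ) : Matrix (k × c) (a × r) ℂ :=
  of fun p q => S (p.1, (q.1, p.2)) q.2

theorem regroup_mul_conjTranspose {k r : Type*} [Fintype k] [Fintype r]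
    (S : Matrix (k × (a × c)) r ℂ) :
    regroup S * (regroup S)ᴴ = traceMid (S * Sᴴ) := by
  ext ⟨x, i⟩ ⟨y, j⟩
  rw [Matrix.mul_apply, Fintype.sum_prod_type]
  rfl

/-- Both sides live on X, the output of `M`, and R: the system of `N` is discarded after the channel
on the left, before it on the right. They agree because `N` preserves the trace. -/
theorem traceMid_purifiedOutput {k r : Type*} [Fintype k] [Fintype r]
    (hN : ∀ ρ, (N ρ).trace = ρ.trace) (M : Matrix c c ℂ →ₗ[ℂ] Matrix d d ℂ)
    (S : Matrix (k × (a × c)) r ℂ) :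
    traceMid ((purifiedOutput (tensorMap N M) S).submatrix
        (Prod.map id (Equiv.prodAssoc b d r).symm) (Prod.map id (Equiv.prodAssoc b d r).symm)) =
      traceMid ((purifiedOutput M (regroup S)).submatrix
        (Prod.map id (midEquiv d a r)) (Prod.map id (midEquiv d a r))) := by
  ext ⟨x, i, l⟩ ⟨y, j, l'⟩
  have h1 := congrFun (congrFun (traceFst_tensorMap hN M
    (vecMulVec (fun i => S (x, i) l) (star fun i => S (y, i) l'))) i) j
  refine Eq.trans h1 ?_
  rw [traceFst_eq_sum, map_sum, Matrix.sum_apply]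
  rfl

/-- The constant collects three discarded systems: the output of `N` from I_c(X⟩B) and again from
I_c(X⟩BR), and the input of `N`, which has become part of the purifying system of `M`. -/
theorem pOne_tensorMap_le [Nonempty a] [Nonempty c] (hN : IsChannel N)
    {M : Matrix c c ℂ →ₗ[ℂ] Matrix d d ℂ} (hM : IsChannel M) :
    pOne (tensorMap N M) ≤ pOne M + (4 * Fintype.card b + 2 * Fintype.card a) := by
  have hNM := hN.tensor hM
  refine csSup_le hNM.privateValues_nonempty fun x hx => ?_
  obtain ⟨k, S, hS, rfl⟩ := exists_of_mem_privateValues hx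
  have hS' : IsClassicalQuantum (regroup S * (regroup S)ᴴ) := by
    rw [regroup_mul_conjTranspose]
    exact hS.traceMid
  have h1 := le_csSup hM.bddAbove_privateValues (hM.mem_privateValues hS')
  have h2 := (abs_le.1 (abs_coherentInfo_traceMid_sub_le (hNM.isState hS.isState))).1
  rw [traceMid_tensorMap hN.2, ← regroup_mul_conjTranspose] at h2
  have hΩ := hNM.isState_purifiedOutput hS.isState
  have hΩ' := hM.isState_purifiedOutput hS'.isState
  have hs : IsState ((purifiedOutput (tensorMap N M) S).submatrix
      (Prod.map id (Equiv.prodAssoc b d _).symm) (Prod.map id (Equiv.prodAssoc b d _).symm)) :=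
    hΩ.submatrix ((Equiv.refl _).prodCongr (Equiv.prodAssoc b d _).symm)
  have hs' : IsState ((purifiedOutput M (regroup S)).submatrix
      (Prod.map id (midEquiv d a _)) (Prod.map id (midEquiv d a _))) :=
    hΩ'.submatrix ((Equiv.refl _).prodCongr (midEquiv d a _))
  have h3 := (abs_le.1 (abs_coherentInfo_traceMid_sub_le hs)).1
  have h4 := (abs_le.1 (abs_coherentInfo_traceMid_sub_le hs')).2
  rw [coherentInfo_submatrix_equiv hΩ.1, traceMid_purifiedOutput hN.2] at h3
  rw [coherentInfo_submatrix_equiv hΩ'.1] at h4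
  rw [pOne]
  linarith

end OneShot

/-! ### Potential quantities. -/

section Potential

variable {a b : Type*} [Fintype a] [DecidableEq a] [Nonempty a] [Fintype b] [DecidableEq b]
  {N : Matrix a a ℂ →ₗ[ℂ] Matrix b b ℂ}

/-- The identity on a one-dimensional space keeps the sets of potential values nonempty, so their
suprema are not default values. -/
theorem exists_isChannel : ∃ M : Matrix (Fin 1) (Fin 1) ℂ →ₗ[ℂ] Matrix (Fin 1) (Fin 1) ℂ,
    IsChannel M := by
  refine ⟨LinearMap.id, (isCompletelyPositive_iff _).2 fun k ρ hρ => ?_, fun _ => rfl⟩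
  have : tensorMap LinearMap.id LinearMap.id ρ = ρ := by
    ext ⟨x, i⟩ ⟨y, j⟩
    rw [tensorMap_id_apply]
    rfl
  rwa [this]

theorem chiPotValues_nonempty (N : Matrix a a ℂ →ₗ[ℂ] Matrix b b ℂ) :
    (chiPotValues N).Nonempty :=
  exists_isChannel.elim fun M hM => ⟨_, 1, 1, M, one_pos, one_pos, hM, rfl⟩

theorem qPotValues_nonempty (N : Matrix a a ℂ →ₗ[ℂ] Matrix b b ℂ) :
    (qPotValues N).Nonempty :=
  exists_isChannel.elim fun M hM => ⟨_, 1, 1, M, one_pos, one_pos, hM, rfl⟩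

theorem pPotValues_nonempty (N : Matrix a a ℂ →ₗ[ℂ] Matrix b b ℂ) :
    (pPotValues N).Nonempty :=
  exists_isChannel.elim fun M hM => ⟨_, 1, 1, M, one_pos, one_pos, hM, rfl⟩

theorem IsChannel.bddAbove_chiPotValues (hN : IsChannel N) : BddAbove (chiPotValues N) := by
  refine ⟨2 * Fintype.card b, ?_⟩
  rintro _ ⟨c, d, M, hc, hd, hM, rfl⟩
  have : NeZero c := ⟨hc.ne'⟩
  linarith [chi_tensorMap_le hN hM]

theorem IsChannel.bddAbove_qPotValues (hN : IsChannel N) : BddAbove (qPotValues N) := by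
  refine ⟨2 * Fintype.card b, ?_⟩
  rintro _ ⟨c, d, M, hc, hd, hM, rfl⟩
  have : NeZero c := ⟨hc.ne'⟩
  linarith [qOne_tensorMap_le hN hM]

theorem IsChannel.bddAbove_pPotValues (hN : IsChannel N) : BddAbove (pPotValues N) := by
  refine ⟨4 * Fintype.card b + 2 * Fintype.card a, ?_⟩
  rintro _ ⟨c, d, M, hc, hd, hM, rfl⟩
  have : NeZero c := ⟨hc.ne'⟩
  linarith [pOne_tensorMap_le hN hM]

/-- A functional convex on all sets of channels has convex potential values. -/
theorem potential_le {c d : ℕ} {G : (Matrix (a × Fin c) (a × Fin c) ℂ →ₗ[ℂ]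
      Matrix (b × Fin d) (b × Fin d) ℂ) → ℝ} (hG : ConvexOn ℝ (channels (a × Fin c) (b × Fin d)) G)
    {N N' : Matrix a a ℂ →ₗ[ℂ] Matrix b b ℂ} (hN : IsChannel N) (hN' : IsChannel N')
    {M : Matrix (Fin c) (Fin c) ℂ →ₗ[ℂ] Matrix (Fin d) (Fin d) ℂ} (hM : IsChannel M)
    {s t : ℝ} (hs : 0 ≤ s) (ht : 0 ≤ t) (hst : s + t = 1) (g : ℝ) :
    G (tensorMap (s • N + t • N') M) - g ≤
      s * (G (tensorMap N M) - g) + t * (G (tensorMap N' M) - g) := by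
  have h := hG.2 (hN.tensor hM) (hN'.tensor hM) hs ht hst
  rw [← tensorMap_convexComb_left, smul_eq_mul, smul_eq_mul] at h
  have h2 : g = s * g + t * g := by rw [← add_mul, hst, one_mul]
  linarith

theorem convexOn_chiPot : ConvexOn ℝ (channels a b) chiPot := by
  refine convexOn_sSup (fun N _ => chiPotValues_nonempty N)
    (fun N hN => IsChannel.bddAbove_chiPotValues hN) ?_
  rintro N hN N' hN' s t hs ht hst _ ⟨c, d, M, hc, hd, hM, rfl⟩
  -- Supplies the nonempty input system required by the convexity of `chi` on channels out of `a ×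
  -- Fin c`.
  have : NeZero c := ⟨hc.ne'⟩
  exact ⟨_, ⟨c, d, M, hc, hd, hM, rfl⟩, _, ⟨c, d, M, hc, hd, hM, rfl⟩,
    potential_le convexOn_chi hN hN' hM hs ht hst _⟩

theorem convexOn_qPot : ConvexOn ℝ (channels a b) qPot := by
  refine convexOn_sSup (fun N _ => qPotValues_nonempty N)
    (fun N hN => IsChannel.bddAbove_qPotValues hN) ?_
  rintro N hN N' hN' s t hs ht hst _ ⟨c, d, M, hc, hd, hM, rfl⟩
  have : NeZero c := ⟨hc.ne'⟩
  exact ⟨_, ⟨c, d, M, hc, hd, hM, rfl⟩, _, ⟨c, d, M, hc, hd, hM, rfl⟩,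
    potential_le convexOn_qOne hN hN' hM hs ht hst _⟩

theorem convexOn_pPot : ConvexOn ℝ (channels a b) pPot := by
  refine convexOn_sSup (fun N _ => pPotValues_nonempty N)
    (fun N hN => IsChannel.bddAbove_pPotValues hN) ?_
  rintro N hN N' hN' s t hs ht hst _ ⟨c, d, M, hc, hd, hM, rfl⟩
  have : NeZero c := ⟨hc.ne'⟩
  exact ⟨_, ⟨c, d, M, hc, hd, hM, rfl⟩, _, ⟨c, d, M, hc, hd, hM, rfl⟩,
    potential_le convexOn_pOne hN hN' hM hs ht hst _⟩

end Potential

end QChannel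

/-! ### The proposition. -/

theorem mainTheorem12 {a b : Type*} [Fintype a] [DecidableEq a] [Nonempty a]
    [Fintype b] [DecidableEq b] [Nonempty b] :
    -- for every channel the six suprema are genuine (finite) suprema
    (∀ N ∈ QChannel.channels a b,
      IsLUB (QChannel.holevoValues N) (QChannel.chi N) ∧
      IsLUB (QChannel.coherentValues N) (QChannel.qOne N) ∧
      IsLUB (QChannel.privateValues N) (QChannel.pOne N) ∧
      IsLUB (QChannel.chiPotValues N) (QChannel.chiPot N) ∧
      IsLUB (QChannel.qPotValues N) (QChannel.qPot N) ∧
      IsLUB (QChannel.pPotValues N) (QChannel.pPot N)) ∧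
    -- the three one-shot quantities are convex on the set of channels
    ConvexOn ℝ (QChannel.channels a b) QChannel.chi ∧
    ConvexOn ℝ (QChannel.channels a b) QChannel.qOne ∧
    ConvexOn ℝ (QChannel.channels a b) QChannel.pOne ∧
    -- and so are the three potential quantities
    ConvexOn ℝ (QChannel.channels a b) QChannel.chiPot ∧
    ConvexOn ℝ (QChannel.channels a b) QChannel.qPot ∧
    ConvexOn ℝ (QChannel.channels a b) QChannel.pPot := by
  refine ⟨fun N hN => ⟨?_, ?_, ?_, ?_, ?_, ?_⟩, QChannel.convexOn_chi, QChannel.convexOn_qOne,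
    QChannel.convexOn_pOne, QChannel.convexOn_chiPot, QChannel.convexOn_qPot,
    QChannel.convexOn_pPot⟩
  · exact isLUB_csSup (QChannel.holevoValues_nonempty N) (show QChannel.IsChannel N from hN).bddAbove_holevoValues
  · exact isLUB_csSup (QChannel.coherentValues_nonempty N) (show QChannel.IsChannel N from hN).bddAbove_coherentValues
  · exact isLUB_csSup (show QChannel.IsChannel N from hN).privateValues_nonempty (show QChannel.IsChannel N from hN).bddAbove_privateValues
  · exact isLUB_csSup (QChannel.chiPotValues_nonempty N) (show QChannel.IsChannel N from hN).bddAbove_chiPotValues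
  · exact isLUB_csSup (QChannel.qPotValues_nonempty N) (show QChannel.IsChannel N from hN).bddAbove_qPotValues
  · exact isLUB_csSup (QChannel.pPotValues_nonempty N) (show QChannel.IsChannel N from hN).bddAbove_pPotValues
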